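/- **Conventions.** $\mathtt{Fin}$ is the skeletal category of the finite sets $\bar n=\{1,\dots,n\}$, $n\ge 0$, with all maps. A $\mathtt{Fin}$-operad $P$ in $\mathrm{Set}$ (equivalently, a unital symmetric one-coloured operad) consists of sets $P(n)$, $n\ge 0$, a unit in $P(1)$, and, for every map $f:\bar n\to\bar m$, a structure map $$\mu^f: P(f^{-1}(1))\times\dots\times P(f^{-1}(m))\times P(m)\to P(n),$$ where the fibre $f^{-1}(i)$ is regarded as an ordinal; these satisfy associativity for composable maps and the two unit axioms. For a $\mathtt{Fin}$-operad $X$, $\mathbb I X=\int_{\mathtt{Fin}}X$ is its operadic Grothendieck construction: its objects are the elements $x\in X(n)$, with cardinality $|x|=\bar n$; a morphism from $x\in X(n)$ to $z\in X(m)$ is a map $f:\bar n\to \bar m$ with elements $\varepsilon_i\in X(f^{-1}(i))$ such that $\mu^f(\varepsilon_1,\dots,\varepsilon_m,z)=x$; its $i$-th fibre is $\varepsilon_i$, and the unit is the chosen terminal object. For operadic categories $\mathcal A$ and $\mathcal B$ with $\mathcal B$ connected, the wreath product $\mathcal A\wr\mathcal B$ is the operadic category with objects $(x;y_1,\dots,y_n)$,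 where $x\in \mathcal A$, $|x|=\bar n$, $y_i\in\mathcal B$; a morphism $(x;y_1,\dots,y_n)\to(z;w_1,\dots,w_k)$ is a morphism $\phi:x\to z$ with a family $\phi_{ij}:y_i\to w_j$ indexed by the pairs with $|\phi|(i)=j$. The cardinality of $(x;y_1,\dots,y_n)$ is the ordinal sum $\bigoplus_i|y_i|$, the cardinality of a morphism is the map induced by $|\phi|$ and the $|\phi_{ij}|$, the fibre over $b\in|w_t|$ is $(\phi^{-1}(t);(\phi_{st}^{-1}(b))_{|\phi|(s)=t})$, and the chosen local terminal objects are the $(u;v)$ with $u$, $v$ chosen local terminal objects of $\mathcal A$, $\mathcal B$. For a connected operadic category $\mathcal O$, $\mathbb A(\mathcal O)$ is the $\mathtt{Fin}$-operad obtained by applying to the terminal $\mathcal O$-operad the left adjoint of restriction along the cardinality functor. That is, it is generated by elements $[T]\in\mathbb A(\mathcal O)(n)$ for the objects $T$ with $|T|=\bar n$, subject to $[U]=1$ for the chosen terminal object $U$, and $\mu^{|f|}([f^{-1}(1)],\dots,[f^{-1}(m)],[S])=[T]$ for all morphisms $f:T\to S$, $|S|=\bar m$. The Boardman–Vogt tensor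 product $X\otimes_{BV}Y$ of $\mathtt{Fin}$-operads is the quotient of the coproduct of $X$ and $Y$ by the interchange relations $\mu^{\nu}(y,\dots,y,x)=\mu^{\sigma}(x,\dots,x,y)$ for $x\in X(n)$, $y\in Y(m)$, where $\nu:\bar m\oplus\dots\oplus\bar m\to\bar n$ sends the $i$-th of the $n$ summands to $i$, and $\sigma:\bar m\oplus\dots\oplus\bar m\to\bar m$ is the identity on each summand. **Theorem.** Let $X$ and $Y$ be $\mathtt{Fin}$-operads in $\mathrm{Set}$ with units $u\in X(1)$ and $v\in Y(1)$. Then there is an isomorphism of operads $$\alpha: X\otimes_{BV}Y\xrightarrow{\ \sim\ }\mathbb A(\mathbb I X\wr\mathbb I Y)$$ such that $\alpha(x)=[(x;v,\dots,v)]$ for all $n\ge0$ and $x\in X(n)$, and $\alpha(y)=[(u;y)]$ for all $m\ge 0$ and $y\in Y(m)$, and whose inverse satisfies $$\alpha^{-1}([(x;y_1,\dots,y_n)])=\mu^{\nu}(y_1,\dots,y_n,x)$$ for all $n\ge0$, $x\in X(n)$ and $y_i\in Y(k_i)$, where $\nu:\bar k_1\oplus\dots\oplus\bar k_n\to\bar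 n$ is the order-preserving map that sends the $i$-th summand to $i$. -/

import Mathlib

open CategoryTheory

namespace WreathBV
universe w v u v₁ u₁ v₂ u₂

/-- A (strict) operadic category: a category `O` with a cardinality functor to the skeletal category
of finite sets (`card`, `cardMap`), a chosen local terminal object in each connected component,
and fibres `fib f i` of each morphism `f : T ⟶ S` over each `i ∈ |S|`.

* `triv T` is the chosen local terminal object of the connected component of `T`; so the chosen
  local terminal objects are exactly the objects `U` with `triv U = U`.
* `emb f i` is the order-preserving inclusion `|f⁻¹(i)| → |T|` with image `|f|⁻¹(i)`. It is uniquely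
  determined by `range_emb`, which says that `|f⁻¹(i)|` is the (skeletal) fibre `|f|⁻¹(i)`.
* `fibMap f g h _ i : h⁻¹(i) ⟶ g⁻¹(i)` is the morphism `f_i` induced by a commutative triangle
  `f ≫ g = h`; it makes `g ↦ g⁻¹(i)` a functor on the slice category, it lies over `|f|_i`, and over a
  chosen local terminal object this functor is the domain functor.
* `fib_fibMap` and `fibMap_fibMap` are the iterated fibre axioms `f_i⁻¹(j) = f⁻¹(j)` and
  `(f_i)_j = f_j` for `j ∈ |g⁻¹(i)| ⊆ |S|`. -/
class OperadicCategory (O : Type u) extends Category.{v} O where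
  card : O → ℕ
  cardMap : ∀ {T S : O}, (T ⟶ S) → Fin (card T) → Fin (card S)
  cardMap_id : ∀ (T : O) (i : Fin (card T)), cardMap (𝟙 T) i = i
  cardMap_comp : ∀ {T S R : O} (f : T ⟶ S) (g : S ⟶ R) (i : Fin (card T)),
    cardMap (f ≫ g) i = cardMap g (cardMap f i)
  triv : O → O
  triv_eq : ∀ {T S : O}, (T ⟶ S) → triv T = triv S
  toTriv : ∀ T : O, T ⟶ triv T
  toTriv_uniq : ∀ {T : O} (f : T ⟶ triv T), f = toTriv T
  card_triv : ∀ T : O, card (triv T) = 1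
  fib : ∀ {T S : O}, (T ⟶ S) → Fin (card S) → O
  emb : ∀ {T S : O} (f : T ⟶ S) (i : Fin (card S)), Fin (card (fib f i)) ↪o Fin (card T)
  range_emb : ∀ {T S : O} (f : T ⟶ S) (i : Fin (card S)),
    Set.range (emb f i) = {a | cardMap f a = i}
  fib_id : ∀ (T : O) (i : Fin (card T)), triv (fib (𝟙 T) i) = fib (𝟙 T) i
  fib_triv : ∀ {T U : O} (f : T ⟶ U), triv U = U → ∀ i : Fin (card U), fib f i = T
  fibMap : ∀ {T S R : O} (f : T ⟶ S) (g : S ⟶ R) (h : T ⟶ R), f ≫ g = h →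
    ∀ i : Fin (card R), fib h i ⟶ fib g i
  emb_fibMap : ∀ {T S R : O} (f : T ⟶ S) (g : S ⟶ R) (h : T ⟶ R) (e : f ≫ g = h)
    (i : Fin (card R)) (a : Fin (card (fib h i))),
    emb g i (cardMap (fibMap f g h e i) a) = cardMap f (emb h i a)
  fibMap_id : ∀ {S R : O} (g : S ⟶ R) (e : 𝟙 S ≫ g = g) (i : Fin (card R)),
    fibMap (𝟙 S) g g e i = 𝟙 (fib g i)
  fibMap_comp : ∀ {T S R Q : O} (f : T ⟶ S) (g : S ⟶ R) (k : R ⟶ Q) (gk : S ⟶ Q) (fgk : T ⟶ Q)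
    (e₁ : f ≫ gk = fgk) (e₂ : g ≫ k = gk) (e₃ : (f ≫ g) ≫ k = fgk) (i : Fin (card Q)),
    fibMap f gk fgk e₁ i ≫ fibMap g k gk e₂ i = fibMap (f ≫ g) k fgk e₃ i
  fibMap_triv : ∀ {T S U : O} (f : T ⟶ S) (g : S ⟶ U) (h : T ⟶ U) (e : f ≫ g = h),
    triv U = U → ∀ i : Fin (card U), fibMap f g h e i ≍ f
  fib_fibMap : ∀ {T S R : O} (f : T ⟶ S) (g : S ⟶ R) (h : T ⟶ R) (e : f ≫ g = h)
    (i : Fin (card R)) (j : Fin (card (fib g i))), fib (fibMap f g h e i) j = fib f (emb g i j)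
  fibMap_fibMap : ∀ {T S R Q : O} (f : T ⟶ S) (g : S ⟶ R) (k : R ⟶ Q)
    (fg : T ⟶ R) (gk : S ⟶ Q) (fgk : T ⟶ Q) (e : f ≫ g = fg)
    (e₁ : f ≫ gk = fgk) (e₂ : g ≫ k = gk) (e₃ : fg ≫ k = fgk) (i : Fin (card Q))
    (e₄ : fibMap f gk fgk e₁ i ≫ fibMap g k gk e₂ i = fibMap fg k fgk e₃ i)
    (j : Fin (card (fib k i))),
    fibMap (fibMap f gk fgk e₁ i) (fibMap g k gk e₂ i) (fibMap fg k fgk e₃ i) e₄ j ≍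
      fibMap f g fg e (emb k i j)

open OperadicCategory

/-- The skeletal category of finite sets: objects `n = {0, …, n - 1}`, all maps as morphisms. -/
structure FinCat where
  len : ℕ

namespace FinCat

instance : Category FinCat where
  Hom S T := Fin S.len → Fin T.len
  id _ := id
  comp f g := g ∘ f

def fibSet {S T : FinCat} (f : S ⟶ T) (i : Fin T.len) : Finset (Fin S.len) :=
  Finset.univ.filter fun a => f a = i

theorem mem_fibSet {S T : FinCat} (f : S ⟶ T) (i : Fin T.len) (a : Fin S.len) :
    a ∈ fibSet f i ↔ f a = i := by simp [fibSet]

/-- The fibre `f⁻¹(i)`, as the ordinal of the same cardinality. -/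
abbrev fiber {S T : FinCat} (f : S ⟶ T) (i : Fin T.len) : FinCat := ⟨(fibSet f i).card⟩

/-- The order-preserving inclusion of the fibre. -/
def fiberEmb {S T : FinCat} (f : S ⟶ T) (i : Fin T.len) : Fin (fiber f i).len ↪o Fin S.len :=
  (fibSet f i).orderEmbOfFin rfl

theorem range_fiberEmb {S T : FinCat} (f : S ⟶ T) (i : Fin T.len) :
    Set.range (fiberEmb f i) = {a | f a = i} := by
  refine (Finset.range_orderEmbOfFin (fibSet f i) rfl).trans ?_
  ext a; exact mem_fibSet f i a

theorem fiberEmb_mem {S T : FinCat} (f : S ⟶ T) (i : Fin T.len) (a : Fin (fiber f i).len) :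
    f (fiberEmb f i a) = i := by
  have : fiberEmb f i a ∈ Set.range (fiberEmb f i) := ⟨a, rfl⟩
  rwa [range_fiberEmb] at this

/-- The map between the fibres of `h` and of `g` induced by `f`. -/
def fiberMap {S T R : FinCat} (f : S ⟶ T) (g : T ⟶ R) (h : S ⟶ R) (e : f ≫ g = h)
    (i : Fin R.len) : fiber h i ⟶ fiber g i := fun a =>
  ((fibSet g i).orderIsoOfFin rfl).symm ⟨f (fiberEmb h i a), by
    rw [mem_fibSet]; subst e; exact fiberEmb_mem (f ≫ g) i a⟩

theorem fiberEmb_fiberMap {S T R : FinCat} (f : S ⟶ T) (g : T ⟶ R) (h : S ⟶ R) (e : f ≫ g = h)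
    (i : Fin R.len) (a : Fin (fiber h i).len) :
    fiberEmb g i (fiberMap f g h e i a) = f (fiberEmb h i a) := by
  have := congrArg Subtype.val (((fibSet g i).orderIsoOfFin rfl).apply_symm_apply
    ⟨f (fiberEmb h i a), by rw [mem_fibSet]; subst e; exact fiberEmb_mem (f ≫ g) i a⟩)
  exact this

end FinCat

theorem orderEmb_unique {n m k : ℕ} (e : Fin n ↪o Fin k) (e' : Fin m ↪o Fin k)
    (h : Set.range e = Set.range e') :
    n = m ∧ ∀ (a : Fin n) (b : Fin m), (a : ℕ) = b → e a = e' b := by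
  have hnm : n = m := by
    have := congrArg Set.ncard h
    rw [← Set.image_univ, ← Set.image_univ, Set.ncard_image_of_injective _ e.injective,
      Set.ncard_image_of_injective _ e'.injective] at this
    simpa [Set.ncard_univ] using this
  subst hnm
  refine ⟨rfl, fun a b hab => ?_⟩
  obtain rfl := Fin.ext hab
  exact congrFun ((StrictMono.range_inj e.strictMono e'.strictMono).1 h) a

namespace FinCat

theorem fiber_eq {S T : FinCat} (f : S ⟶ T) (i : Fin T.len) {n : ℕ} (e : Fin n ↪o Fin S.len)
    (h : Set.range e = {a | f a = i}) : fiber f i = ⟨n⟩ :=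
  congrArg FinCat.mk (orderEmb_unique (fiberEmb f i) e ((range_fiberEmb f i).trans h.symm)).1

theorem hom_heq {S S' T T' : FinCat} (hS : S = S') (hT : T = T') (f : S ⟶ T) (f' : S' ⟶ T')
    (h : ∀ (a : Fin S.len) (b : Fin S'.len), (a : ℕ) = b → (f a : ℕ) = f' b) : f ≍ f' := by
  subst hS hT
  exact heq_of_eq (funext fun a => Fin.ext (h a a rfl))

theorem range_comp_emb {S T R : FinCat} (f : S ⟶ T) (g : T ⟶ R) (h : S ⟶ R) (e : f ≫ g = h)
    (i : Fin R.len) (j : Fin (fiber g i).len) :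
    Set.range ((fiberEmb (fiberMap f g h e i) j).trans (fiberEmb h i)) =
      {a | f a = fiberEmb g i j} := by
  ext a
  simp only [Set.mem_range, RelEmbedding.coe_trans, Function.comp, Set.mem_ofPred_eq]
  constructor
  · rintro ⟨b, rfl⟩
    rw [← fiberEmb_fiberMap f g h e]; exact congrArg _ (fiberEmb_mem (fiberMap f g h e i) j b)
  · intro ha
    have h1 : a ∈ Set.range (fiberEmb h i) := by
      rw [range_fiberEmb]; subst e
      show g (f a) = i
      rw [ha]; exact fiberEmb_mem g i j
    obtain ⟨b, rfl⟩ := h1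
    have h2 : b ∈ Set.range (fiberEmb (fiberMap f g h e i) j) := by
      rw [range_fiberEmb]
      apply (fiberEmb g i).injective
      rw [fiberEmb_fiberMap, ha]
    obtain ⟨c, rfl⟩ := h2
    exact ⟨c, rfl⟩

/-- The operadic category `Fin`; its only chosen local terminal object is the one-point set. -/
instance : OperadicCategory FinCat where
  card T := T.len
  cardMap f := f
  cardMap_id _ _ := rfl
  cardMap_comp _ _ _ := rfl
  triv _ := ⟨1⟩
  triv_eq _ := rfl
  toTriv _ := fun _ => 0
  toTriv_uniq f := funext fun _ => Subsingleton.elim (α := Fin 1) _ _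
  card_triv _ := rfl
  fib := fiber
  emb := fiberEmb
  range_emb := range_fiberEmb
  fib_id T i := (fiber_eq (𝟙 T) i (n := 1) (OrderEmbedding.ofStrictMono (fun _ => i)
    (fun a b h => absurd h (by simp [Subsingleton.elim a b]))) (by
      ext a; simp only [Set.mem_range, Set.mem_ofPred_eq]
      exact ⟨fun ⟨_, h⟩ => h.symm, fun h => ⟨0, h.symm⟩⟩)).symm
  fib_triv {T U} f hU i := by
    subst hU; exact fiber_eq f i (n := T.len) (RelEmbedding.refl _) (by
      ext a; simpa using Subsingleton.elim (α := Fin 1) _ _)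
  fibMap := fiberMap
  emb_fibMap := fiberEmb_fiberMap
  fibMap_id g e i := funext fun a => (fiberEmb g i).injective (fiberEmb_fiberMap _ _ _ e i a)
  fibMap_comp f g k gk fgk e₁ e₂ e₃ i := funext fun a => (fiberEmb k i).injective (by
    rw [fiberEmb_fiberMap]
    exact (fiberEmb_fiberMap g k gk e₂ i _).trans
      (congrArg g (fiberEmb_fiberMap f gk fgk e₁ i a)))
  fibMap_triv {T S R} f g h e hU i := by
    subst hU
    have key : ∀ {A : FinCat} (f : A ⟶ ⟨1⟩) (i : Fin 1),
        fiber f i = A ∧ ∀ (a : Fin _) (b : Fin _), (a : ℕ) = b → fiberEmb f i a = b := by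
      intro A f i
      have := orderEmb_unique (fiberEmb f i) (RelEmbedding.refl (· ≤ ·)) (by
        rw [range_fiberEmb]; ext a; simpa using Subsingleton.elim (α := Fin 1) _ _)
      exact ⟨congrArg FinCat.mk this.1, this.2⟩
    refine hom_heq (key h i).1 (key g i).1 _ _ fun (a : Fin _) (b : Fin _) hab => ?_
    have h1 := fiberEmb_fiberMap f g h e i a
    rw [(key h i).2 a b hab] at h1
    have hl : (fiber g i).len = S.len := congrArg FinCat.len (key g i).1
    rw [(key g i).2 _ (Fin.cast hl (fiberMap f g h e i a)) rfl] at h1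
    exact congrArg Fin.val h1
  fib_fibMap f g h e i j := (fiber_eq f (fiberEmb g i j) _ (range_comp_emb f g h e i j)).symm
  fibMap_fibMap f g k fg gk fgk e e₁ e₂ e₃ i e₄ j := by
    have h1 := orderEmb_unique _ _ ((range_comp_emb fg k fgk e₃ i j).trans
      (range_fiberEmb fg (fiberEmb k i j)).symm)
    have h2 := orderEmb_unique _ _ ((range_comp_emb g k gk e₂ i j).trans
      (range_fiberEmb g (fiberEmb k i j)).symm)
    refine hom_heq (congrArg FinCat.mk h1.1) (congrArg FinCat.mk h2.1) _ _ fun (a : Fin _) (b : Fin _) hab => ?_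
    set c := fiberMap (fiberMap f gk fgk e₁ i) (fiberMap g k gk e₂ i)
      (fiberMap fg k fgk e₃ i) e₄ j a with hc
    have h3 : fiberEmb g (fiberEmb k i j) (Fin.cast h2.1 c) =
        fiberEmb g (fiberEmb k i j) (fiberMap f g fg e (fiberEmb k i j) b) := by
      rw [← h2.2 c _ rfl, fiberEmb_fiberMap, ← h1.2 a b hab]
      simp only [RelEmbedding.coe_trans, Function.comp]
      rw [hc, fiberEmb_fiberMap, fiberEmb_fiberMap]
    exact congrArg Fin.val ((fiberEmb _ _).injective h3)

end FinCat

section Basic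
variable {O : Type u} [OperadicCategory.{v} O]

theorem triv_triv (T : O) : triv (triv T) = triv T :=
  (triv_eq (toTriv T)).symm

theorem cardMap_emb {T S : O} (f : T ⟶ S) (i : Fin (card S)) (a : Fin (card (fib f i))) :
    cardMap f (emb f i a) = i := by
  have : emb f i a ∈ Set.range (emb f i) := ⟨a, rfl⟩
  rwa [range_emb] at this

theorem emb_emb {T S R : O} (f : T ⟶ S) (g : S ⟶ R) (h : T ⟶ R) (e : f ≫ g = h)
    (i : Fin (card R)) (j : Fin (card (fib g i))) :
    ∀ (a : Fin (card (fib (fibMap f g h e i) j))) (b : Fin (card (fib f (emb g i j)))),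
    (a : ℕ) = b → emb h i (emb (fibMap f g h e i) j a) = emb f (emb g i j) b := by
  refine (orderEmb_unique ((emb (fibMap f g h e i) j).trans (emb h i)) (emb f (emb g i j)) ?_).2
  ext a
  simp only [range_emb, Set.mem_range, RelEmbedding.coe_trans, Function.comp, Set.mem_ofPred_eq]
  constructor
  · rintro ⟨b, rfl⟩
    rw [← emb_fibMap f g h e, cardMap_emb]
  · intro ha
    have h1 : a ∈ Set.range (emb h i) := by
      rw [range_emb, Set.mem_ofPred_eq, ← e, cardMap_comp, ha, cardMap_emb]
    obtain ⟨b, rfl⟩ := h1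
    have h2 : b ∈ Set.range (emb (fibMap f g h e i) j) := by
      rw [range_emb]
      apply (emb g i).injective
      rw [emb_fibMap, ha]
    obtain ⟨c, rfl⟩ := h2
    exact ⟨c, rfl⟩

theorem emb_id (T : O) (i : Fin (card T)) (a : Fin _) : emb (𝟙 T) i a = i := by
  have := cardMap_emb (𝟙 T) i a
  rwa [cardMap_id] at this

theorem emb_triv {T U : O} (f : T ⟶ U) (hU : triv U = U) (i : Fin (card U)) :
    ∀ (a : Fin (card (fib f i))) (b : Fin (card T)), (a : ℕ) = b → emb f i a = b := by
  refine (orderEmb_unique (emb f i) (RelEmbedding.refl (· ≤ ·)) ?_).2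
  have hs : ∀ j, j = i := by
    have : card U = 1 := by rw [← hU, card_triv]
    intro j; ext; omega
  rw [range_emb]; ext a; simpa using hs _

theorem fibMap_congr {T S R : O} {f f' : T ⟶ S} {g g' : S ⟶ R} {h h' : T ⟶ R}
    (ef : f = f') (eg : g = g') (eh : h = h') (e : f ≫ g = h) (e' : f' ≫ g' = h')
    (i : Fin (card R)) : fibMap f g h e i ≍ fibMap f' g' h' e' i := by
  subst ef eg eh; rfl

end Basic

/-- A (unital) operad in sets over an operadic category: structure maps
`μ^f : ∏ᵢ P(f⁻¹(i)) × P(S) → P(T)` for every `f : T ⟶ S`, and a unit in `P(U)` for every chosen local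
terminal object `U`. Operads over `FinCat` are the unital symmetric operads in sets.

The argument `F` of `mu` is forced to be `fib f` by the equality that follows it, so that `mu` is
just `μ^f`; it only makes it possible to apply `μ^f` to elements of `P(F i)` when `F i` is equal to
`f⁻¹(i)` but not by definition. -/
structure Operad (O : Type u) [OperadicCategory.{v} O] where
  obj : O → Type w
  mu : ∀ {T S : O} (f : T ⟶ S) (F : Fin (card S) → O), (∀ i, fib f i = F i) →
    (∀ i, obj (F i)) → obj S → obj T
  one : ∀ U : O, triv U = U → obj U
  mu_one : ∀ {T : O} (x : obj T),
    mu (𝟙 T) (fib (𝟙 T)) (fun _ => rfl) (fun i => one _ (fib_id T i)) x = x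
  one_mu : ∀ {T U : O} (f : T ⟶ U) (h : triv U = U) (x : obj T),
    mu f (fun _ => T) (fib_triv f h) (fun _ => x) (one U h) = x
  assoc : ∀ {T S R : O} (f : T ⟶ S) (g : S ⟶ R) (ε : ∀ i, obj (fib f i))
    (δ : ∀ i, obj (fib g i)) (z : obj R),
    mu f (fib f) (fun _ => rfl) ε (mu g (fib g) (fun _ => rfl) δ z) =
      mu (f ≫ g) (fib (f ≫ g)) (fun _ => rfl)
        (fun i => mu (fibMap f g (f ≫ g) rfl i) (fun j => fib f (emb g i j))
          (fib_fibMap f g (f ≫ g) rfl i) (fun j => ε (emb g i j)) (δ i)) z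

namespace Operad
variable {O : Type u} [OperadicCategory.{v} O]

/-- Morphisms of operads over a fixed operadic category. -/
@[ext]
structure Hom (P Q : Operad.{w} O) where
  app : ∀ {T : O}, P.obj T → Q.obj T
  map_mu : ∀ {T S : O} (f : T ⟶ S) (ε : ∀ i, P.obj (fib f i)) (z : P.obj S),
    app (P.mu f (fib f) (fun _ => rfl) ε z) =
      Q.mu f (fib f) (fun _ => rfl) (fun i => app (ε i)) (app z)
  map_one : ∀ (U : O) (h : triv U = U), app (P.one U h) = Q.one U h

instance : Category (Operad.{w} O) where
  Hom := Hom
  id P := ⟨fun x => x, fun _ _ _ => rfl, fun _ _ => rfl⟩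
  comp α β := ⟨fun x => β.app (α.app x),
    fun f ε z => by rw [α.map_mu, β.map_mu], fun U h => by rw [α.map_one, β.map_one]⟩

/-- The terminal operad over `O`. -/
def terminal (O : Type u) [OperadicCategory.{v} O] : Operad.{w} O where
  obj _ := PUnit
  mu _ _ _ _ _ := ⟨⟩
  one _ _ := ⟨⟩
  mu_one _ := rfl
  one_mu _ _ _ := rfl
  assoc _ _ _ _ _ := rfl

variable (P : Operad.{w} O)

theorem mu_congr {T T' S S' : O} (hT : T = T') (hS : S = S') (f : T ⟶ S) (f' : T' ⟶ S')
    (hf : f ≍ f') (F : Fin (card S) → O) (F' : Fin (card S') → O) (hF : ∀ i, fib f i = F i)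
    (hF' : ∀ i, fib f' i = F' i) (ε : ∀ i, P.obj (F i)) (ε' : ∀ i, P.obj (F' i))
    (hε : ∀ (i : Fin (card S)) (i' : Fin (card S')), (i : ℕ) = i' → ε i ≍ ε' i') (z : P.obj S) (z' : P.obj S') (hz : z ≍ z') :
    P.mu f F hF ε z ≍ P.mu f' F' hF' ε' z' := by
  subst hT hS
  obtain rfl := eq_of_heq hf
  obtain rfl := eq_of_heq hz
  obtain rfl : fib f = F := funext hF
  obtain rfl : fib f = F' := funext hF'
  obtain rfl : ε = ε' := funext fun i => eq_of_heq (hε i i rfl)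
  rfl

theorem one_congr {U U' : O} (h : U = U') (hU : triv U = U) (hU' : triv U' = U') :
    P.one U hU ≍ P.one U' hU' := by
  subst h; rfl

theorem mu_ones {T : O} (f : T ⟶ T) (hf : f = 𝟙 T) (F : Fin (card T) → O)
    (hF : ∀ i, fib f i = F i) (ε : ∀ i, P.obj (F i)) (hU : ∀ i, triv (F i) = F i)
    (hε : ∀ i, ε i = P.one (F i) (hU i)) (x : P.obj T) : P.mu f F hF ε x = x := by
  subst hf
  obtain rfl : fib (𝟙 T) = F := funext hF
  obtain rfl : ε = _ := funext hε
  exact P.mu_one x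

theorem mu_over_triv {T U : O} (hU : triv U = U) (f : T ⟶ U) (F : Fin (card U) → O)
    (hF : ∀ i, fib f i = F i) (ε : ∀ i, P.obj (F i)) (i : Fin (card U)) :
    P.mu f F hF ε (P.one U hU) ≍ ε i := by
  obtain rfl : F = fun _ => T := funext fun j => by rw [← hF, fib_triv f hU]
  have hs : ∀ j, j = i := by
    have : card U = 1 := by rw [← hU, card_triv]
    intro j; ext; omega
  have h2 : ε = fun _ => ε i := funext fun j => by rw [hs j]
  rw [h2]
  exact heq_of_eq (P.one_mu f hU _)

theorem assoc' {T S R : O} (f : T ⟶ S) (g : S ⟶ R) (h : T ⟶ R) (e : f ≫ g = h)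
    (F : Fin (card S) → O) (hF : ∀ i, fib f i = F i) (G : Fin (card R) → O)
    (hG : ∀ i, fib g i = G i) (ε : ∀ i, P.obj (F i)) (δ : ∀ i, P.obj (G i)) (z : P.obj R)
    (H : Fin (card R) → O) (hH : ∀ i, fib h i = H i) (ζ : ∀ i, P.obj (H i))
    (hζ : ∀ i, P.mu (fibMap f g h e i) (fun j => F (emb g i j))
      (fun j => (fib_fibMap f g h e i j).trans (hF _)) (fun j => ε (emb g i j))
        (cast (congrArg P.obj (hG i).symm) (δ i)) ≍ ζ i) :
    P.mu f F hF ε (P.mu g G hG δ z) = P.mu h H hH ζ z := by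
  subst e
  obtain rfl : fib f = F := funext hF
  obtain rfl : fib g = G := funext hG
  obtain rfl : fib (f ≫ g) = H := funext hH
  obtain rfl : _ = ζ := funext fun i => eq_of_heq (hζ i)
  exact P.assoc f g ε δ z

end Operad

/-- The operadic Grothendieck construction `∫_O P`: objects are the elements `x ∈ P(T)`, `T ∈ O`.
For a `Fin`-operad `X` this is the operadic category `𝕀X`. -/
structure Groth {O : Type u} [OperadicCategory.{v} O] (P : Operad.{w} O) where
  base : O
  elt : P.obj base

namespace Groth
variable {O : Type u} [OperadicCategory.{v} O] {P : Operad.{w} O}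

/-- A morphism from `x ∈ P(T)` to `z ∈ P(S)`: a morphism `f : T ⟶ S` and elements `ε_i ∈ P(f⁻¹(i))`
with `μ^f(ε, z) = x`. -/
structure Hom (x z : Groth P) where
  base : x.base ⟶ z.base
  elt : ∀ i, P.obj (fib base i)
  mu_eq : P.mu base (fib base) (fun _ => rfl) elt z.elt = x.elt

theorem obj_ext {x y : Groth P} (h : x.base = y.base) (h' : x.elt ≍ y.elt) : x = y := by
  cases x; cases y; cases h; cases h'; rfl

theorem hom_ext {x z : Groth P} {f g : Hom x z} (h : f.base = g.base)
    (h' : ∀ i, f.elt i ≍ g.elt i) : f = g := by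
  obtain ⟨f, ε, e⟩ := f
  obtain ⟨g, δ, e'⟩ := g
  dsimp only at h
  subst h
  obtain rfl : ε = δ := funext fun i => eq_of_heq (h' i)
  rfl

theorem hom_heq {x x' z z' : Groth P} (hx : x = x') (hz : z = z') (f : Hom x z) (g : Hom x' z')
    (h : f.base ≍ g.base) (h' : ∀ (i : Fin (card z.base)) (i' : Fin (card z'.base)), (i : ℕ) = i' → f.elt i ≍ g.elt i') : f ≍ g := by
  subst hx hz
  exact heq_of_eq (hom_ext (eq_of_heq h) fun i => h' i i rfl)

def Hom.id (x : Groth P) : Hom x x :=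
  ⟨𝟙 _, fun i => P.one _ (fib_id _ i), P.mu_one _⟩

/-- The composite of `(f, ε)` and `(g, δ)`: over `i`, it is `μ^{f_i}` of the `ε_j` and `δ_i`. -/
def Hom.comp {x y z : Groth P} (f : Hom x y) (g : Hom y z) : Hom x z :=
  ⟨f.base ≫ g.base, fun i => P.mu (fibMap f.base g.base _ rfl i)
    (fun j => fib f.base (emb g.base i j)) (fib_fibMap _ _ _ rfl i)
    (fun j => f.elt (emb g.base i j)) (g.elt i), by
      rw [← P.assoc, g.mu_eq, f.mu_eq]⟩

theorem heq_elt {x y : Groth P} (f : Hom x y) {i j : Fin (card y.base)} (h : i = j) :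
    f.elt i ≍ f.elt j := by subst h; rfl

instance : Category (Groth P) where
  Hom := Hom
  id := Hom.id
  comp := Hom.comp
  id_comp {x y} f := by
    refine hom_ext (Category.id_comp _) fun i => ?_
    have h : ∀ (g : x.base ⟶ y.base) (e : 𝟙 x.base ≫ f.base = g) (hg : g = f.base)
        (F : Fin (card (fib f.base i)) → O) (hF : ∀ j, fib (fibMap (𝟙 x.base) f.base g e i) j = F j)
        (ε : ∀ j, P.obj (F j)) (hU : ∀ j, triv (F j) = F j) (hε : ∀ j, ε j = P.one _ (hU j)),
        P.mu (fibMap (𝟙 x.base) f.base g e i) F hF ε (f.elt i) ≍ f.elt i := by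
      intro g e hg F hF ε hU hε
      subst hg
      exact heq_of_eq (P.mu_ones _ (fibMap_id _ _ _) F hF ε hU hε _)
    exact h _ rfl (Category.id_comp _) _ _ _ (fun j => fib_id _ _) fun j => rfl
  comp_id {x y} f := by
    refine hom_ext (Category.comp_id _) fun i => ?_
    have hc : card (fib (𝟙 y.base) i) = 1 := by rw [← fib_id, card_triv]
    exact (P.mu_over_triv (fib_id _ i) _ _ _ _ (Fin.cast hc.symm 0)).trans
      (heq_elt f (emb_id _ _ _))
  assoc {x y z w} f g h := by
    refine hom_ext (Category.assoc _ _ _) fun i => ?_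
    have key : ∀ (fgh : x.base ⟶ w.base) (e₁ : f.base ≫ (g.base ≫ h.base) = fgh)
       (e₃ : (f.base ≫ g.base) ≫ h.base = fgh),
       P.mu (fibMap (f.base ≫ g.base) h.base fgh e₃ i)
         (fun j => fib (f.base ≫ g.base) (emb h.base i j)) (fib_fibMap _ _ _ _ i)
         (fun j => (f.comp g).elt (emb h.base i j)) (h.elt i) =
       P.mu (fibMap f.base (g.base ≫ h.base) fgh e₁ i)
         (fun j => fib f.base (emb (g.base ≫ h.base) i j)) (fib_fibMap _ _ _ _ i)
         (fun j => f.elt (emb (g.base ≫ h.base) i j)) ((g.comp h).elt i) := by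
      intro fgh e₁ e₃
      symm
      refine P.assoc' _ _ _ (fibMap_comp _ _ _ _ _ e₁ rfl e₃ i) _ _ _ _ _ _ _ _ _ _ fun j => ?_
      refine P.mu_congr ?_ ?_ _ _ (fibMap_fibMap _ _ _ _ _ _ _ _ _ _ _ _ _) _ _ _ _ _ _ ?_ _ _ ?_
      · exact fib_fibMap _ _ _ _ _ _
      · exact fib_fibMap _ _ _ _ _ _
      · intro a b hab
        apply heq_elt
        exact emb_emb _ _ _ rfl _ _ a b hab
      · exact cast_heq _ _
    have hA : fibMap (f.base ≫ g.base) h.base _ rfl i ≍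
        fibMap (f.base ≫ g.base) h.base _ (Category.assoc _ _ _) i :=
      fibMap_congr rfl rfl (Category.assoc _ _ _) _ _ i
    refine HEq.trans ?_ (heq_of_eq (key _ rfl (Category.assoc _ _ _)))
    refine P.mu_congr (by rw [Category.assoc]) rfl _ _ hA _ _ _ _ _ _ (fun (a : Fin _) (b : Fin _) hab => ?_) _ _ HEq.rfl
    obtain rfl := Fin.ext hab
    exact HEq.rfl

/-- The induced morphism between the fibres over `i`. -/
def fibreMap {x y z : Groth P} (f : x ⟶ y) (g : y ⟶ z) (h : x ⟶ z) (e : f ≫ g = h)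
    (i : Fin (card z.base)) :
    (⟨fib h.base i, h.elt i⟩ : Groth P) ⟶ (⟨fib g.base i, g.elt i⟩ : Groth P) where
  base := fibMap f.base g.base h.base (congrArg Hom.base e) i
  elt j := cast (congrArg P.obj (fib_fibMap _ _ _ _ i j).symm) (f.elt (emb g.base i j))
  mu_eq := by
    subst e
    apply eq_of_heq
    refine P.mu_congr rfl rfl _ _ HEq.rfl _ (fun j => fib f.base (emb g.base i j)) _
      (fib_fibMap _ _ _ rfl i) _ (fun j => f.elt (emb g.base i j)) (fun a b hab => ?_) _ _ HEq.rfl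
    obtain rfl := Fin.ext hab
    exact cast_heq _ _

theorem elt_over_triv {x : Groth P} {U : O} (hU : triv U = U) (f : x ⟶ ⟨U, P.one U hU⟩)
    (i : Fin (card U)) : f.elt i ≍ x.elt :=
  (P.mu_over_triv hU f.base _ _ f.elt i).symm.trans (heq_of_eq f.mu_eq)

theorem trivial_eq {x : Groth P}
    (hx : (⟨triv x.base, P.one _ (triv_triv _)⟩ : Groth P) = x) :
    ∃ (U : O) (hU : triv U = U), x = ⟨U, P.one U hU⟩ :=
  ⟨_, _, hx.symm⟩

/-- The `i`-th fibre of `(f, ε) : x ⟶ z` is `ε_i`; the chosen local terminal objects are the units. -/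
instance : OperadicCategory (Groth P) where
  card x := card x.base
  cardMap f := cardMap f.base
  cardMap_id x := cardMap_id x.base
  cardMap_comp f g := cardMap_comp f.base g.base
  triv x := ⟨triv x.base, P.one _ (triv_triv _)⟩
  triv_eq f := obj_ext (triv_eq f.base) (P.one_congr (triv_eq f.base) _ _)
  toTriv x := ⟨toTriv x.base, fun i => cast (congrArg P.obj (fib_triv _ (triv_triv _) i).symm) x.elt,
    eq_of_heq ((P.mu_over_triv (triv_triv _) _ _ _ _
      (Fin.cast (card_triv _).symm 0)).trans (cast_heq _ _))⟩
  toTriv_uniq {x} f := hom_ext (toTriv_uniq f.base) fun i =>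
    (elt_over_triv (triv_triv _) f i).trans (cast_heq _ _).symm
  card_triv x := card_triv x.base
  fib f i := ⟨fib f.base i, f.elt i⟩
  emb f i := emb f.base i
  range_emb f i := range_emb f.base i
  fib_id x i := obj_ext (fib_id x.base i) (P.one_congr (fib_id x.base i) _ _)
  fib_triv {x z} f hz i := by
    obtain ⟨U, hU, rfl⟩ := trivial_eq hz
    exact obj_ext (fib_triv f.base hU i) (elt_over_triv hU f i)
  fibMap := fibreMap
  emb_fibMap f g h e i := emb_fibMap f.base g.base h.base _ i
  fibMap_id {x z} g e i := by
    refine hom_ext (fibMap_id g.base (congrArg Hom.base e) i) fun j => ?_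
    exact (cast_heq _ _).trans (P.one_congr
      ((fib_fibMap _ _ _ (congrArg Hom.base e) i j).symm.trans
        (congrArg (fun q => fib q j) (fibMap_id g.base (congrArg Hom.base e) i))) _ _)
  fibMap_comp {x y z w} f g k gk fgk e₁ e₂ e₃ i := by
    refine hom_ext (fibMap_comp f.base g.base k.base gk.base fgk.base
      (congrArg Hom.base e₁) (congrArg Hom.base e₂) (congrArg Hom.base e₃) i) fun j => ?_
    refine HEq.trans ?_ (cast_heq _ _).symm
    change P.mu _ (fun a => fib (fibreMap f gk fgk e₁ i).base (emb (fibreMap g k gk e₂ i).base j a)) _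
        (fun a => (fibreMap f gk fgk e₁ i).elt (emb (fibreMap g k gk e₂ i).base j a))
        ((fibreMap g k gk e₂ i).elt j) ≍
      P.mu _ (fun a => fib f.base (emb g.base (emb k.base i j) a)) _
        (fun a => f.elt (emb g.base (emb k.base i j) a)) (g.elt (emb k.base i j))
    refine P.mu_congr ((congrArg (fun q => fib q j) (fibMap_comp _ _ _ _ _ (congrArg Hom.base e₁)
      (congrArg Hom.base e₂) (congrArg Hom.base e₃) i)).trans
        (fib_fibMap (f.base ≫ g.base) k.base fgk.base (congrArg Hom.base e₃) i j))
      (fib_fibMap g.base k.base gk.base (congrArg Hom.base e₂) i j) _ _ ?_ _ _ _ _ _ _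
      (fun a b hab => ?_) _ _ ?_
    rotate_left
    · exact (cast_heq _ _).trans
        (heq_elt f (emb_emb _ _ _ (congrArg Hom.base e₂) _ _ a b hab))
    · exact cast_heq _ _
    exact (fibMap_congr rfl rfl (fibMap_comp _ _ _ _ _ (congrArg Hom.base e₁)
      (congrArg Hom.base e₂) (congrArg Hom.base e₃) i) _ _ j).trans
      (fibMap_fibMap f.base g.base k.base (f.base ≫ g.base) gk.base fgk.base rfl
        (congrArg Hom.base e₁) (congrArg Hom.base e₂) (congrArg Hom.base e₃) i
        (fibMap_comp _ _ _ _ _ _ _ _ i) j)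
  fibMap_triv {x y z} f g h e hz i := by
    obtain ⟨U, hU, rfl⟩ := trivial_eq hz
    refine hom_heq (obj_ext (fib_triv h.base hU i) (elt_over_triv hU h i))
      (obj_ext (fib_triv g.base hU i) (elt_over_triv hU g i)) _ _
      (fibMap_triv f.base g.base h.base _ hU i) fun a b hab => ?_
    refine (cast_heq _ _).trans (heq_elt f (emb_triv _ hU i a b hab))
  fib_fibMap f g h e i j := obj_ext (fib_fibMap _ _ _ _ i j) (cast_heq _ _)
  fibMap_fibMap {x y z w} f g k fg gk fgk e e₁ e₂ e₃ i e₄ j := by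
    refine hom_heq (obj_ext (fib_fibMap _ _ _ _ i j) (cast_heq _ _))
      (obj_ext (fib_fibMap _ _ _ _ i j) (cast_heq _ _)) _ _
      (fibMap_fibMap f.base g.base k.base fg.base gk.base fgk.base (congrArg Hom.base e) _ _ _ i _ j)
      fun a b hab => ?_
    refine (cast_heq _ _).trans ((cast_heq _ _).trans (HEq.trans (heq_elt f ?_) (cast_heq _ _).symm))
    exact emb_emb _ _ _ (congrArg Hom.base e₂) _ _ a b hab

end Groth

section Connected
variable {O : Type u} [OperadicCategory.{v} O]

theorem triv_eqToHom {S T : O} (h : S = T) (b : Fin (card T)) :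
    triv (fib (eqToHom h) b) = fib (eqToHom h) b := by
  subst h; exact fib_id _ _

theorem triv_const [IsConnected O] (S T : O) : triv S = triv T :=
  constant_of_preserves_morphisms triv (fun _ _ f => triv_eq f) S T

theorem isConnected_of_triv [Nonempty O] (h : ∀ S T : O, triv S = triv T) : IsConnected O :=
  zigzag_isConnected fun S T =>
    (Zigzag.of_hom (toTriv S)).trans ((h S T) ▸ Zigzag.of_inv (toTriv T))

instance : IsConnected FinCat :=
  have : Nonempty FinCat := ⟨⟨0⟩⟩
  isConnected_of_triv fun _ _ => rfl

instance [IsConnected O] (P : Operad.{w} O) : IsConnected (Groth P) :=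
  have : Nonempty (Groth P) :=
    (IsConnected.is_nonempty (J := O)).map fun T => ⟨triv T, P.one _ (triv_triv T)⟩
  isConnected_of_triv fun x y =>
    Groth.obj_ext (triv_const x.base y.base) (P.one_congr (triv_const x.base y.base) _ _)

variable (O) in
/-- The chosen terminal object of a connected operadic category. -/
noncomputable def point [IsConnected O] : O := triv (Classical.choice (IsConnected.is_nonempty (J := O)))

theorem point_eq [IsConnected O] (S : O) : triv S = point O := triv_const _ _

theorem triv_point [IsConnected O] : triv (point O) = point O := point_eq _

theorem hom_point_unique [IsConnected O] {S T : O} (hT : T = point O) (f g : S ⟶ T) : f = g := by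
  rw [← point_eq S] at hT
  subst hT
  rw [toTriv_uniq f, toTriv_uniq g]

end Connected

/-- The identification of the disjoint union `⊔ᵢ m i` with the ordinal sum `∑ᵢ m i`. -/
abbrev sig {n : ℕ} {m : Fin n → ℕ} : (Σ i, Fin (m i)) ≃ Fin (∑ i, m i) := finSigmaFinEquiv

theorem sig_lt_of_lex {n : ℕ} {m : Fin n → ℕ} (p q : Σ i, Fin (m i))
    (h : p.1 < q.1 ∨ p.1 = q.1 ∧ (p.2 : ℕ) < q.2) : sig p < sig q := by
  let m' : ℕ → ℕ := fun i => if h : i < n then m ⟨i, h⟩ else 0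
  have key : ∀ p : Σ i, Fin (m i), (sig p : ℕ) = ∑ i ∈ Finset.range p.1, m' i + p.2 := by
    intro p
    rw [sig, finSigmaFinEquiv_apply, ← Fin.sum_univ_eq_sum_range]
    congr 1
    refine Finset.sum_congr rfl fun i _ => ?_
    have : (i : ℕ) < n := i.2.trans p.1.2
    simp [m', this, Fin.castLE]
  rw [Fin.lt_def, key, key]
  rcases h with h | ⟨h, h'⟩
  · have h1 : ∑ i ∈ Finset.range (p.1 + 1), m' i ≤ ∑ i ∈ Finset.range q.1, m' i :=
      Finset.sum_le_sum_of_subset (Finset.range_subset_range.2 h)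
    rw [Finset.sum_range_succ] at h1
    have h2 : m' p.1 = m p.1 := by simp [m']
    have := p.2.2
    omega
  · have : (p.1 : ℕ) = q.1 := congrArg Fin.val h
    rw [this]; omega

theorem lex_of_sig_lt {n : ℕ} {m : Fin n → ℕ} (p q : Σ i, Fin (m i))
    (h : sig p < sig q) : p.1 < q.1 ∨ p.1 = q.1 ∧ (p.2 : ℕ) < q.2 := by
  by_contra hc
  have h1 : q.1 < p.1 ∨ q.1 = p.1 ∧ (q.2 : ℕ) < p.2 ∨ p = q := by
    obtain ⟨i, a⟩ := p
    obtain ⟨j, b⟩ := q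
    simp only at hc
    rcases lt_trichotomy i j with h | h | h
    · exact absurd (Or.inl h) hc
    · subst h
      rcases lt_trichotomy (a : ℕ) b with h' | h' | h'
      · exact absurd (Or.inr ⟨rfl, h'⟩) hc
      · exact Or.inr (Or.inr (by rw [Fin.ext h']))
      · exact Or.inr (Or.inl ⟨rfl, h'⟩)
    · exact Or.inl h
  rcases h1 with h1 | h1 | h1
  · exact absurd (sig_lt_of_lex q p (Or.inl h1)) (not_lt_of_gt h)
  · exact absurd (sig_lt_of_lex q p (Or.inr h1)) (not_lt_of_gt h)
  · rw [h1] at h; exact lt_irrefl _ h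

/-- Objects `(x; y₁, …, yₙ)` of the wreath product `A ≀ B` of operadic categories, where `|x| = n`
and `B` is connected (so that the `yᵢ` lie in the same connected component). -/
structure Wreath (A : Type u₁) (B : Type u₂) [OperadicCategory.{v₁} A] [OperadicCategory.{v₂} B]
    [IsConnected B] where
  base : A
  elt : Fin (card base) → B

namespace Wreath
variable {A : Type u₁} {B : Type u₂} [OperadicCategory.{v₁} A] [OperadicCategory.{v₂} B]
  [IsConnected B]

/-- A morphism `(x; y₁, …, yₙ) ⟶ (z; w₁, …, w_k)`: a morphism `φ : x ⟶ z` and a family of morphisms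
`φᵢⱼ : yᵢ ⟶ wⱼ` indexed by the pairs with `|φ|(i) = j`. -/
@[ext]
structure Hom (x z : Wreath A B) where
  base : x.base ⟶ z.base
  elt : ∀ (i : Fin (card x.base)) (j : Fin (card z.base)), cardMap base i = j →
    (x.elt i ⟶ z.elt j)

theorem obj_ext {x y : Wreath A B} (h : x.base = y.base)
    (h' : ∀ (i : Fin (card x.base)) (j : Fin (card y.base)), (i : ℕ) = j → x.elt i = y.elt j) :
    x = y := by
  obtain ⟨x, a⟩ := x
  obtain ⟨y, b⟩ := y
  dsimp only at h
  subst h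
  obtain rfl : a = b := funext fun i => h' i i rfl
  rfl

theorem hom_ext {x z : Wreath A B} {f g : Hom x z} (h : f.base = g.base)
    (h' : ∀ i j hf hg, f.elt i j hf = g.elt i j hg) : f = g := by
  obtain ⟨f, ε⟩ := f
  obtain ⟨g, δ⟩ := g
  dsimp only at h
  subst h
  obtain rfl : ε = δ := funext fun i => funext fun j => funext fun e => h' i j e e
  rfl

theorem hom_heq {x x' z z' : Wreath A B} (hx : x = x') (hz : z = z') (f : Hom x z) (g : Hom x' z')
    (h : f.base ≍ g.base)
    (h' : ∀ (i : Fin (card x.base)) (i' : Fin (card x'.base)) (j : Fin (card z.base))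
      (j' : Fin (card z'.base)), (i : ℕ) = i' → (j : ℕ) = j' →
      ∀ hf hg, f.elt i j hf ≍ g.elt i' j' hg) : f ≍ g := by
  subst hx hz
  exact heq_of_eq (hom_ext (eq_of_heq h) fun i j hf hg => eq_of_heq (h' i i j j rfl rfl hf hg))

def Hom.id (x : Wreath A B) : Hom x x :=
  ⟨𝟙 x.base, fun i j h => eqToHom (by rw [← h, cardMap_id])⟩

def Hom.comp {x y z : Wreath A B} (f : Hom x y) (g : Hom y z) : Hom x z :=
  ⟨f.base ≫ g.base, fun i k h =>
    f.elt i (cardMap f.base i) rfl ≫ g.elt (cardMap f.base i) k (by rw [← h, cardMap_comp])⟩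

theorem Hom.comp_elt {x y z : Wreath A B} (f : Hom x y) (g : Hom y z)
    (i : Fin (card x.base)) (j : Fin (card y.base)) (k : Fin (card z.base))
    (h₁ : cardMap f.base i = j) (h₂ : cardMap g.base j = k)
    (h₃ : cardMap (f.comp g).base i = k) :
    (f.comp g).elt i k h₃ = f.elt i j h₁ ≫ g.elt j k h₂ := by
  subst h₁; rfl

instance : Category (Wreath A B) where
  Hom := Hom
  id := Hom.id
  comp := Hom.comp
  id_comp {x z} f := hom_ext (Category.id_comp _) fun i j h h' =>
    (Hom.comp_elt (Hom.id x) f i i j (cardMap_id _ _) h' h).trans (Category.id_comp _)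
  comp_id {x z} f := hom_ext (Category.comp_id _) fun i j h h' =>
    (Hom.comp_elt f (Hom.id z) i j j h' (cardMap_id _ _) h).trans (Category.comp_id _)
  assoc {x y z w} f g k := hom_ext (Category.assoc _ _ _) fun i j h h' => by
    have h₀ : cardMap (f.comp g).base i = cardMap g.base (cardMap f.base i) := cardMap_comp _ _ _
    have h₁ : cardMap (g.comp k).base (cardMap f.base i) = j := (cardMap_comp _ _ _).symm.trans h'
    have h₂ : cardMap k.base (cardMap g.base (cardMap f.base i)) = j :=
      (cardMap_comp _ _ _).symm.trans h₁
    rw [Hom.comp_elt (f.comp g) k i _ j h₀ h₂ h,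
      Hom.comp_elt f g i _ _ rfl rfl, Hom.comp_elt f (g.comp k) i _ j rfl h₁,
      Hom.comp_elt g k _ _ j rfl h₂, Category.assoc]

theorem comp_elt {x y z : Wreath A B} (f : x ⟶ y) (g : y ⟶ z) (h : x ⟶ z) (e : f ≫ g = h)
    (i : Fin (card x.base)) (j : Fin (card y.base)) (k : Fin (card z.base))
    (h₁ : cardMap f.base i = j) (h₂ : cardMap g.base j = k) (h₃ : cardMap h.base i = k) :
    f.elt i j h₁ ≫ g.elt j k h₂ = h.elt i k h₃ := by
  subst e h₁; rfl

/-- The disjoint union of the `|yᵢ|`; the cardinality of `(x; y)` is the ordinal sum of the `|yᵢ|`. -/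
abbrev Index (x : Wreath A B) : Type := Σ i, Fin (card (x.elt i))

/-- The cardinality of a morphism, on disjoint unions: `(i, a) ↦ (j, |φᵢⱼ|(a))` for `j = |φ|(i)`. -/
def indexMap {x z : Wreath A B} (f : x ⟶ z) (p : x.Index) : z.Index :=
  ⟨cardMap f.base p.1, cardMap (f.elt p.1 _ rfl) p.2⟩

theorem indexMap_mk {x z : Wreath A B} (f : x ⟶ z) (i : Fin (card x.base)) (a) (j)
    (h : cardMap f.base i = j) : indexMap f ⟨i, a⟩ = ⟨j, cardMap (f.elt i j h) a⟩ := by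
  subst h; rfl

/-- The fibre over `(t, b)`, `b ∈ |w_t|`: it is `(φ⁻¹(t); (φ_{st}⁻¹(b))_{s ∈ |φ|⁻¹(t)})`. -/
def fibre {x z : Wreath A B} (f : x ⟶ z) (q : z.Index) : Wreath A B where
  base := fib f.base q.1
  elt s := fib (f.elt (emb f.base q.1 s) q.1 (cardMap_emb _ _ _)) q.2

/-- The inclusion of the cardinality of the fibre. -/
def fibreInc {x z : Wreath A B} (f : x ⟶ z) (q : z.Index) (p : (fibre f q).Index) : x.Index :=
  ⟨emb f.base q.1 p.1, emb (f.elt (emb f.base q.1 p.1) q.1 (cardMap_emb _ _ _)) q.2 p.2⟩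

theorem fibreInc_strictMono {x z : Wreath A B} (f : x ⟶ z) (q : z.Index) :
    StrictMono fun a => sig (fibreInc f q (sig.symm a)) := by
  intro a b hab
  obtain ⟨p, rfl⟩ := sig.surjective a
  obtain ⟨p', rfl⟩ := sig.surjective b
  simp only [Equiv.symm_apply_apply]
  apply sig_lt_of_lex
  rcases lex_of_sig_lt _ _ hab with h | ⟨h, h'⟩
  · exact Or.inl ((emb f.base q.1).strictMono h)
  · obtain ⟨s, a⟩ := p
    obtain ⟨s', b⟩ := p'
    dsimp only at h h'
    subst h
    exact Or.inr ⟨rfl, (emb _ q.2).strictMono h'⟩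

theorem range_fibreInc {x z : Wreath A B} (f : x ⟶ z) (q : z.Index) :
    Set.range (fibreInc f q) = {p | indexMap f p = q} := by
  ext ⟨i, a⟩
  obtain ⟨t, b⟩ := q
  simp only [Set.mem_range, Set.mem_ofPred_eq]
  constructor
  · rintro ⟨⟨s, c⟩, h⟩
    rw [← h]
    exact (indexMap_mk f _ _ t (cardMap_emb f.base t s)).trans
      (congrArg (Sigma.mk t) (cardMap_emb (f.elt _ t (cardMap_emb _ _ _)) b c))
  · intro h
    have h1 : cardMap f.base i = t := congrArg Sigma.fst h
    rw [indexMap_mk f i a t h1] at h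
    have h2 : cardMap (f.elt i t h1) a = b := by simpa using h
    have h3 : i ∈ Set.range (emb f.base t) := by rw [range_emb]; exact h1
    obtain ⟨s, rfl⟩ := h3
    have h4 : a ∈ Set.range (emb (f.elt (emb f.base t s) t h1) b) := by rw [range_emb]; exact h2
    obtain ⟨c, rfl⟩ := h4
    exact ⟨⟨s, c⟩, rfl⟩

/-- The induced morphism between the fibres over `q`. -/
def fibreMap {x y z : Wreath A B} (f : x ⟶ y) (g : y ⟶ z) (h : x ⟶ z) (e : f ≫ g = h)
    (q : z.Index) : fibre h q ⟶ fibre g q where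
  base := fibMap f.base g.base h.base (congrArg Hom.base e) q.1
  elt s s' hs :=
    have h1 : cardMap f.base (emb h.base q.1 s) = emb g.base q.1 s' :=
      (emb_fibMap f.base g.base h.base (congrArg Hom.base e) _ _).symm.trans (congrArg _ hs)
    fibMap (f.elt (emb h.base q.1 s) (emb g.base q.1 s') h1)
      (g.elt (emb g.base q.1 s') q.1 (cardMap_emb _ _ _))
      (h.elt (emb h.base q.1 s) q.1 (cardMap_emb _ _ _)) (comp_elt f g h e _ _ _ _ _ _) q.2

theorem indexMap_id (x : Wreath A B) (p : x.Index) : indexMap (𝟙 x) p = p := by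
  obtain ⟨i, a⟩ := p
  rw [indexMap_mk (𝟙 x) i a i (cardMap_id _ _)]
  exact congrArg (Sigma.mk i) (cardMap_id _ _)

theorem indexMap_comp {x y z : Wreath A B} (f : x ⟶ y) (g : y ⟶ z) (p : x.Index) :
    indexMap (f ≫ g) p = indexMap g (indexMap f p) := by
  obtain ⟨i, a⟩ := p
  rw [indexMap_mk (f ≫ g) i a _ (cardMap_comp _ _ _),
    ← comp_elt f g _ rfl i _ _ rfl rfl (cardMap_comp _ _ _), cardMap_comp]
  rfl

theorem indexMap_fibreMap {x y z : Wreath A B} (f : x ⟶ y) (g : y ⟶ z) (h : x ⟶ z)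
    (e : f ≫ g = h) (q : z.Index) (p : (fibre h q).Index) :
    fibreInc g q (indexMap (fibreMap f g h e q) p) = indexMap f (fibreInc h q p) := by
  obtain ⟨s, a⟩ := p
  have h1 : cardMap f.base (emb h.base q.1 s) =
      emb g.base q.1 (cardMap (fibMap f.base g.base h.base (congrArg Hom.base e) q.1) s) :=
    (emb_fibMap f.base g.base h.base (congrArg Hom.base e) _ _).symm
  refine Eq.trans ?_ (indexMap_mk f _ _ _ h1).symm
  exact congrArg (Sigma.mk _) (emb_fibMap _ _ _ _ _ _)

theorem triv_hom_unique {x y : Wreath A B} (hb : triv y.base = y.base)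
    (he : ∀ i, y.elt i = point B) (f g : x ⟶ y) : f = g := by
  obtain ⟨y, c⟩ := y
  have hb' : triv x.base = y := (triv_eq f.base).trans hb
  change triv x.base = y at hb'
  subst hb'
  exact hom_ext ((toTriv_uniq f.base).trans (toTriv_uniq g.base).symm)
    fun i j _ _ => hom_point_unique (he j) _ _

theorem fibre_triv {x z : Wreath A B} (f : x ⟶ z) (hb : triv z.base = z.base)
    (he : ∀ i, z.elt i = point B) (q : z.Index) : fibre f q = x :=
  obj_ext (fib_triv f.base hb q.1) fun (i : Fin (card (fib f.base q.1))) j hij => by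
    have h1 : emb f.base q.1 i = j := emb_triv f.base hb q.1 i j hij
    subst h1
    exact fib_triv _ (by rw [he, triv_point]) _

theorem fibre_fibreMap {x y z : Wreath A B} (f : x ⟶ y) (g : y ⟶ z) (h : x ⟶ z) (e : f ≫ g = h)
    (q : z.Index) (p : (fibre g q).Index) :
    fibre (fibreMap f g h e q) p = fibre f (fibreInc g q p) := by
  obtain ⟨s', b⟩ := p
  refine obj_ext (fib_fibMap f.base g.base h.base (congrArg Hom.base e) q.1 s')
    fun (i : Fin (card (fib (fibMap f.base g.base h.base (congrArg Hom.base e) q.1) s')))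
      (j : Fin (card (fib f.base (emb g.base q.1 s')))) hij => ?_
  have h1 := emb_emb f.base g.base h.base (congrArg Hom.base e) q.1 s' i j hij
  refine (fib_fibMap _ _ _ _ _ _).trans ?_
  have : ∀ (k k' : Fin (card x.base)) (hk : k = k') (h₁ : cardMap f.base k = emb g.base q.1 s')
      (h₂ : cardMap f.base k' = emb g.base q.1 s') (c : Fin (card (y.elt (emb g.base q.1 s')))),
      fib (f.elt k _ h₁) c = fib (f.elt k' _ h₂) c := by
    intro k k' hk h₁ h₂ c; subst hk; rfl
  exact this _ _ h1 _ _ _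

theorem fibMap_elt_congr {x y z : Wreath A B} (f : x ⟶ y) (g : y ⟶ z) (h : x ⟶ z) (e : f ≫ g = h)
    {i i' : Fin (card x.base)} (hi : i = i') {j j' : Fin (card y.base)} (hj : j = j')
    {l : Fin (card z.base)} (h₁ : cardMap f.base i = j) (h₂ : cardMap g.base j = l)
    (h₃ : cardMap h.base i = l) (h₁' : cardMap f.base i' = j') (h₂' : cardMap g.base j' = l)
    (h₃' : cardMap h.base i' = l) (b : Fin (card (z.elt l))) :
    fibMap (f.elt i j h₁) (g.elt j l h₂) (h.elt i l h₃) (comp_elt f g h e _ _ _ _ _ _) b ≍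
      fibMap (f.elt i' j' h₁') (g.elt j' l h₂') (h.elt i' l h₃') (comp_elt f g h e _ _ _ _ _ _) b := by
  subst hi hj; rfl

theorem elt_congr {x y : Wreath A B} (f : x ⟶ y) {i i' : Fin (card x.base)} (hi : i = i')
    {j j' : Fin (card y.base)} (hj : j = j') (h : cardMap f.base i = j)
    (h' : cardMap f.base i' = j') : f.elt i j h ≍ f.elt i' j' h' := by
  subst hi hj; rfl

theorem fibre_id (x : Wreath A B) (q : x.Index) :
    (⟨triv (fibre (𝟙 x) q).base, fun _ => point B⟩ : Wreath A B) = fibre (𝟙 x) q :=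
  obj_ext (fib_id _ _) fun _ _ _ => (point_eq _).symm.trans
    (triv_eqToHom (congrArg x.elt (emb_id _ _ _)) _)

theorem fibreMap_id {x z : Wreath A B} (g : x ⟶ z) (e : 𝟙 x ≫ g = g) (q : z.Index) :
    fibreMap (𝟙 x) g g e q = 𝟙 (fibre g q) := by
  refine hom_ext (fibMap_id g.base (congrArg Hom.base e) q.1) ?_
  intro s s' hf hg
  have hs : s = s' := (cardMap_id (fib g.base q.1) s).symm.trans hg
  subst hs
  exact fibMap_id _ _ _

theorem fibreMap_comp {x y z w : Wreath A B} (f : x ⟶ y) (g : y ⟶ z) (k : z ⟶ w)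
    (gk : y ⟶ w) (fgk : x ⟶ w) (e₁ : f ≫ gk = fgk) (e₂ : g ≫ k = gk) (e₃ : (f ≫ g) ≫ k = fgk)
    (q : w.Index) :
    fibreMap f gk fgk e₁ q ≫ fibreMap g k gk e₂ q = fibreMap (f ≫ g) k fgk e₃ q := by
  refine hom_ext (fibMap_comp f.base g.base k.base gk.base fgk.base (congrArg Hom.base e₁)
    (congrArg Hom.base e₂) (congrArg Hom.base e₃) q.1) ?_
  intro s s' hf hg
  refine (comp_elt _ _ _ rfl s _ s' rfl ((cardMap_comp _ _ _).symm.trans hf) hf).symm.trans ?_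
  have hE := comp_elt f g (f ≫ g) rfl (emb fgk.base q.1 s) _ (emb k.base q.1 s')
    ((emb_fibMap f.base gk.base fgk.base (congrArg Hom.base e₁) q.1 s).symm)
    ((emb_fibMap g.base k.base gk.base (congrArg Hom.base e₂) q.1 _).symm.trans
      (congrArg _ ((cardMap_comp _ _ _).symm.trans hf)))
    ((emb_fibMap (f.base ≫ g.base) k.base fgk.base (congrArg Hom.base e₃) q.1 s).symm.trans
      (congrArg _ hg))
  refine (fibMap_comp _ _ _ _ _ (comp_elt f gk fgk e₁ _ _ _ _ _ _) (comp_elt g k gk e₂ _ _ _ _ _ _)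
    ((congrArg (· ≫ k.elt _ _ _) hE).trans (comp_elt (f ≫ g) k fgk e₃ _ _ _ _ _ _)) q.2).trans ?_
  exact eq_of_heq (fibMap_congr hE rfl rfl _ _ _)

theorem fibreMap_fibreMap {x y z w : Wreath A B} (f : x ⟶ y) (g : y ⟶ z) (k : z ⟶ w)
    (fg : x ⟶ z) (gk : y ⟶ w) (fgk : x ⟶ w) (e : f ≫ g = fg)
    (e₁ : f ≫ gk = fgk) (e₂ : g ≫ k = gk) (e₃ : fg ≫ k = fgk) (q : w.Index)
    (e₄ : fibreMap f gk fgk e₁ q ≫ fibreMap g k gk e₂ q = fibreMap fg k fgk e₃ q)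
    (p : (fibre k q).Index) :
    fibreMap (fibreMap f gk fgk e₁ q) (fibreMap g k gk e₂ q) (fibreMap fg k fgk e₃ q) e₄ p ≍
      fibreMap f g fg e (fibreInc k q p) := by
  refine hom_heq (fibre_fibreMap _ _ _ _ _ _) (fibre_fibreMap _ _ _ _ _ _) _ _
    (fibMap_fibMap f.base g.base k.base fg.base gk.base fgk.base (congrArg Hom.base e)
      (congrArg Hom.base e₁) (congrArg Hom.base e₂) (congrArg Hom.base e₃) q.1
      (congrArg Hom.base e₄) p.1) ?_
  obtain ⟨t, b⟩ := q
  obtain ⟨s, c⟩ := p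
  intro i i' j j' hi hj hf hg
  have hi' : emb fgk.base t (emb (fibMap fg.base k.base fgk.base (congrArg Hom.base e₃) t) s i) =
      emb fg.base (emb k.base t s) i' := emb_emb _ _ _ _ _ _ _ _ hi
  have hj' : emb gk.base t (emb (fibMap g.base k.base gk.base (congrArg Hom.base e₂) t) s j) =
      emb g.base (emb k.base t s) j' := emb_emb _ _ _ _ _ _ _ _ hj
  have h₁ := (congrArg (cardMap fg.base) hi').trans (cardMap_emb _ _ _)
  refine (fibMap_fibMap _ _ _ (fg.elt _ (emb k.base t s) h₁) _ _
    (comp_elt f g fg e _ _ _ _ _ _) _ _ _ _ _ _).trans ?_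
  exact fibMap_elt_congr f g fg e hi' hj' _ _ _ _ _ _ _

/-- The wreath product `A ≀ B` as an operadic category; local terminal objects are `(u; v)`. -/
noncomputable instance : OperadicCategory (Wreath A B) where
  card x := ∑ i, card (x.elt i)
  cardMap f a := sig (indexMap f (sig.symm a))
  cardMap_id x a := by rw [indexMap_id, Equiv.apply_symm_apply]
  cardMap_comp f g a := by rw [indexMap_comp, Equiv.symm_apply_apply]
  triv x := ⟨triv x.base, fun _ => point B⟩
  triv_eq f := obj_ext (triv_eq f.base) fun _ _ _ => rfl
  toTriv x := ⟨toTriv x.base, fun i _ _ => toTriv (x.elt i) ≫ eqToHom (point_eq _)⟩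
  toTriv_uniq f := triv_hom_unique (triv_triv _) (fun _ => rfl) _ _
  card_triv x := by
    have h : card (point B) = 1 := card_triv _
    simp [h, card_triv]
  fib f a := fibre f (sig.symm a)
  emb f a := OrderEmbedding.ofStrictMono _ (fibreInc_strictMono f (sig.symm a))
  range_emb f a := by
    ext b
    have := Set.ext_iff.1 (range_fibreInc f (sig.symm a)) (sig.symm b)
    simp only [Set.mem_range, Set.mem_ofPred_eq] at this
    simp only [Set.mem_range, OrderEmbedding.coe_ofStrictMono, Set.mem_ofPred_eq]
    rw [← Equiv.eq_symm_apply, ← this]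
    exact ⟨fun ⟨c, hc⟩ => ⟨sig.symm c, by rw [← hc, Equiv.symm_apply_apply]⟩,
      fun ⟨c, hc⟩ => ⟨sig c, by rw [Equiv.symm_apply_apply, hc, Equiv.apply_symm_apply]⟩⟩
  fib_id x a := fibre_id x _
  fib_triv {x z} f hz a := by
    have hb : triv z.base = z.base := congrArg Wreath.base hz
    have he : ∀ i, z.elt i = point B := by rw [← hz]; exact fun _ => rfl
    exact fibre_triv f hb he _
  fibMap f g h e a := fibreMap f g h e (sig.symm a)
  emb_fibMap f g h e a b := by
    obtain ⟨p, rfl⟩ := sig.surjective b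
    simp only [OrderEmbedding.coe_ofStrictMono, Equiv.symm_apply_apply]
    exact congrArg sig (indexMap_fibreMap f g h e _ p)
  fibMap_id {x z} g e a := fibreMap_id g e _
  fibMap_comp f g k gk fgk e₁ e₂ e₃ a := fibreMap_comp f g k gk fgk e₁ e₂ e₃ _
  fibMap_triv {x y z} f g h e hz a := by
    have hb : triv z.base = z.base := congrArg Wreath.base hz
    have he : ∀ i, z.elt i = point B := by rw [← hz]; exact fun _ => rfl
    refine hom_heq (fibre_triv h hb he _) (fibre_triv g hb he _) _ _
      (fibMap_triv f.base g.base h.base (congrArg Hom.base e) hb _) ?_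
    intro i i' j j' hi hj hf hg
    refine (fibMap_triv _ _ _ _ (by rw [he, triv_point]) _).trans (elt_congr f ?_ ?_ _ _)
    · exact emb_triv h.base hb _ _ _ hi
    · exact emb_triv g.base hb _ _ _ hj
  fib_fibMap f g h e a b :=
    (fibre_fibreMap f g h e _ _).trans (congrArg (fibre f) (Equiv.symm_apply_apply _ _).symm)
  fibMap_fibMap f g k fg gk fgk e e₁ e₂ e₃ a e₄ b := by
    refine (fibreMap_fibreMap f g k fg gk fgk e e₁ e₂ e₃ _ e₄ _).trans ?_
    have : ∀ q q', q = q' → fibreMap f g fg e q ≍ fibreMap f g fg e q' := by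
      intro q q' h; subst h; rfl
    exact this _ _ (Equiv.symm_apply_apply _ _).symm

end Wreath

instance {A : Type u₁} {B : Type u₂} [OperadicCategory.{v₁} A] [OperadicCategory.{v₂} B]
    [IsConnected A] [IsConnected B] : IsConnected (Wreath A B) :=
  have : Nonempty (Wreath A B) := ⟨⟨point A, fun _ => point B⟩⟩
  isConnected_of_triv fun x y =>
    Wreath.obj_ext (triv_const x.base y.base) fun _ _ _ => rfl

/-- Formal operadic composites of elements of a collection `E`; modulo the operad axioms they form
the free `Fin`-operad on `E`. -/
inductive Term (E : FinCat → Type w) : FinCat → Type w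
  | gen {n : FinCat} : E n → Term E n
  | one (U : FinCat) : triv U = U → Term E U
  | mu {S T : FinCat} (f : S ⟶ T) (F : Fin (card T) → FinCat) (hF : ∀ i, fib f i = F i) :
      (∀ i, Term E (F i)) → Term E T → Term E S

/-- The smallest congruence on formal composites that contains `r` and the operad axioms. -/
inductive Rel {E : FinCat → Type w} (r : ∀ n : FinCat, Term E n → Term E n → Prop) :
    ∀ {n : FinCat}, Term E n → Term E n → Prop
  | of {n : FinCat} {s t : Term E n} : r n s t → Rel r s t
  | refl {n : FinCat} (t : Term E n) : Rel r t t
  | symm {n : FinCat} {s t : Term E n} : Rel r s t → Rel r t s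
  | trans {n : FinCat} {s t q : Term E n} : Rel r s t → Rel r t q → Rel r s q
  | mu_congr {S T : FinCat} (f : S ⟶ T) (F : Fin (card T) → FinCat) (hF : ∀ i, fib f i = F i)
      {ε ε' : ∀ i, Term E (F i)} {z z' : Term E T} :
      (∀ i, Rel r (ε i) (ε' i)) → Rel r z z' → Rel r (.mu f F hF ε z) (.mu f F hF ε' z')
  | mu_one {T : FinCat} (x : Term E T) :
      Rel r (.mu (𝟙 T) (fib (𝟙 T)) (fun _ => rfl) (fun i => .one _ (fib_id T i)) x) x
  | one_mu {T U : FinCat} (f : T ⟶ U) (h : triv U = U) (x : Term E T) :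
      Rel r (.mu f (fun _ => T) (fib_triv f h) (fun _ => x) (.one U h)) x
  | assoc {T S R : FinCat} (f : T ⟶ S) (g : S ⟶ R) (ε : ∀ i, Term E (fib f i))
      (δ : ∀ i, Term E (fib g i)) (z : Term E R) :
      Rel r (.mu f (fib f) (fun _ => rfl) ε (.mu g (fib g) (fun _ => rfl) δ z))
        (.mu (f ≫ g) (fib (f ≫ g)) (fun _ => rfl)
          (fun i => .mu (fibMap f g (f ≫ g) rfl i) (fun j => fib f (emb g i j))
            (fib_fibMap f g (f ≫ g) rfl i) (fun j => ε (emb g i j)) (δ i)) z)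

section Presented
variable (E : FinCat → Type w) (r : ∀ n : FinCat, Term E n → Term E n → Prop)

def relSetoid (n : FinCat) : Setoid (Term E n) :=
  ⟨Rel r, Rel.refl, Rel.symm, Rel.trans⟩

variable {E} in
/-- The class of a formal composite. -/
def cls {n : FinCat} (t : Term E n) : Quotient (relSetoid E r n) := Quotient.mk _ t

theorem cls_eq {n : FinCat} {s t : Term E n} (h : Rel r s t) : cls r s = cls r t :=
  Quotient.sound h

theorem out_rel {n : FinCat} (t : Term E n) : Rel r (cls r t).out t :=
  Quotient.exact (Quotient.out_eq (cls r t))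

/-- The structure maps induced on classes of formal composites. -/
noncomputable def qmu {S T : FinCat} (f : S ⟶ T) (F : Fin (card T) → FinCat)
    (hF : ∀ i, fib f i = F i) (ε : ∀ i, Quotient (relSetoid E r (F i)))
    (z : Quotient (relSetoid E r T)) : Quotient (relSetoid E r S) :=
  cls r (.mu f F hF (fun i => (ε i).out) z.out)

theorem qmu_cls {S T : FinCat} (f : S ⟶ T) (F : Fin (card T) → FinCat)
    (hF : ∀ i, fib f i = F i) (ε : ∀ i, Term E (F i)) (z : Term E T) :
    qmu E r f F hF (fun i => cls r (ε i)) (cls r z) = cls r (.mu f F hF ε z) :=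
  cls_eq E r (.mu_congr f F hF (fun i => out_rel E r (ε i)) (out_rel E r z))

/-- The `Fin`-operad with generators `E` and relations `r`: the quotient of the free `Fin`-operad on
`E` by the operadic congruence generated by `r`. -/
noncomputable def presented : Operad.{w} FinCat where
  obj n := Quotient (relSetoid E r n)
  mu := qmu E r
  one U h := cls r (.one U h)
  mu_one {T} x := by
    obtain ⟨x, rfl⟩ := Quotient.exists_rep x
    exact (qmu_cls E r _ _ _ _ x).trans (cls_eq E r (.mu_one x))
  one_mu f h x := by
    obtain ⟨x, rfl⟩ := Quotient.exists_rep x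
    exact (qmu_cls E r _ _ _ (fun _ => x) _).trans (cls_eq E r (.one_mu f h x))
  assoc f g ε δ z := by
    obtain ⟨z, rfl⟩ := Quotient.exists_rep z
    obtain ⟨ε, rfl⟩ : ∃ ε', ε = fun i => cls r (ε' i) :=
      ⟨fun i => (ε i).out, funext fun i => (Quotient.out_eq _).symm⟩
    obtain ⟨δ, rfl⟩ : ∃ δ', δ = fun i => cls r (δ' i) :=
      ⟨fun i => (δ i).out, funext fun i => (Quotient.out_eq _).symm⟩
    refine (congrArg (qmu E r f _ _ _) (qmu_cls E r g _ _ δ z)).trans ?_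
    refine (qmu_cls E r f _ _ ε _).trans ((cls_eq E r (.assoc f g ε δ z)).trans ?_)
    refine (qmu_cls E r _ _ _ _ z).symm.trans ?_
    exact congrArg (fun q => qmu E r _ _ _ q (cls r z)) (funext fun i =>
      (qmu_cls E r _ _ _ (fun j => ε (emb g i j)) (δ i)).symm)

end Presented

section Reflection
variable {O : Type u} [OperadicCategory.{v} O]

/-- The cardinality of a morphism, as a morphism of `FinCat`. -/
def cardHom {T S : O} (f : T ⟶ S) : (⟨card T⟩ : FinCat) ⟶ ⟨card S⟩ := cardMap f

theorem fib_cardHom {T S : O} (f : T ⟶ S) (i : Fin (card S)) :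
    fib (cardHom f) i = ⟨card (fib f i)⟩ :=
  FinCat.fiber_eq (cardHom f) i (emb f i) (range_emb f i)

theorem card_of_triv {U : O} (hU : triv U = U) : card U = 1 := by rw [← hU, card_triv]

/-- The generating collection `E(n) = ∐_{|T| = n} P(T)`. -/
abbrev leftExtGen (P : Operad.{w} O) (n : FinCat) : Type (max u w) :=
  {p : Groth P // card p = n.len}

/-- The relations `μ^{|f|}([ε₁], …, [ε_m], [z]) = [μ_P^f(ε₁, …, ε_m, z)]`, and `[e] = 1` for the units `e`
of `P`. -/
inductive LeftExtRel (P : Operad.{w} O) :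
    ∀ n : FinCat, Term (leftExtGen P) n → Term (leftExtGen P) n → Prop
  | mu {T S : O} (f : T ⟶ S) (ε : ∀ i, P.obj (fib f i)) (z : P.obj S) :
      LeftExtRel P ⟨card T⟩
        (.mu (cardHom f) (fun i => ⟨card (fib f i)⟩) (fib_cardHom f)
          (fun i => .gen ⟨⟨fib f i, ε i⟩, rfl⟩) (.gen ⟨⟨S, z⟩, rfl⟩))
        (.gen ⟨⟨T, P.mu f (fib f) (fun _ => rfl) ε z⟩, rfl⟩)
  | one (U : O) (hU : triv U = U) :
      LeftExtRel P ⟨1⟩ (.gen ⟨⟨U, P.one U hU⟩, (card_of_triv hU : card U = 1)⟩) (.one ⟨1⟩ rfl)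

/-- The left adjoint, on an operad `P` over a connected operadic category `O`, of the restriction
along the arity functor of `O` (which for connected `O` is the cardinality functor to `FinCat`). -/
noncomputable def leftExt [IsConnected O] (P : Operad.{w} O) : Operad.{max u w} FinCat :=
  presented (leftExtGen P) (LeftExtRel P)

variable (O) in
/-- The symmetric operad `𝔸(O)` of a connected operadic category `O`: the left adjoint `leftExt`
applied to the terminal operad over `O`. -/
noncomputable def reflect [IsConnected O] : Operad.{u} FinCat :=
  leftExt (Operad.terminal.{0} O)

/-- The class `[T]` of an object `T` of `O` with `|T| = n`, in `𝔸(O)(n)`. -/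
noncomputable def reflect.gen [IsConnected O] (T : O) (n : FinCat) (h : card T = n.len) :
    (reflect O).obj n :=
  cls _ (.gen ⟨⟨T, ⟨⟩⟩, h⟩)

end Reflection

section BoardmanVogt

/-- The order-preserving map `ν : k₁ ⊕ ⋯ ⊕ kₙ → n` that sends `kᵢ` to `i`. -/
def blockMap {n : ℕ} (k : Fin n → ℕ) : (⟨∑ i, k i⟩ : FinCat) ⟶ ⟨n⟩ := fun a => (sig.symm a).1

theorem fib_blockMap {n : ℕ} (k : Fin n → ℕ) (i : Fin n) : fib (blockMap k) i = ⟨k i⟩ :=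
  FinCat.fiber_eq (blockMap k) i (OrderEmbedding.ofStrictMono (fun a => sig ⟨i, a⟩)
    fun _ _ h => sig_lt_of_lex _ _ (Or.inr ⟨rfl, h⟩)) (by
      ext b
      obtain ⟨⟨j, b⟩, rfl⟩ := sig.surjective b
      simp only [Set.mem_range, Set.mem_ofPred_eq, blockMap, Equiv.symm_apply_apply]
      constructor
      · rintro ⟨a, h⟩; exact (congrArg Sigma.fst (sig.injective h)).symm
      · rintro rfl; exact ⟨b, rfl⟩)

/-- The projection `m ⊕ ⋯ ⊕ m → m` (`n` summands) that is the identity on each summand. -/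
def foldMap (n m : ℕ) : (⟨∑ _ : Fin n, m⟩ : FinCat) ⟶ ⟨m⟩ := fun a =>
  (sig (m := fun _ : Fin n => m).symm a).2

theorem fib_foldMap (n m : ℕ) (j : Fin m) : fib (foldMap n m) j = ⟨n⟩ :=
  FinCat.fiber_eq (foldMap n m) j (OrderEmbedding.ofStrictMono
    (fun i => sig (m := fun _ : Fin n => m) ⟨i, j⟩)
    fun _ _ h => sig_lt_of_lex _ _ (Or.inl h)) (by
      ext b
      obtain ⟨⟨i, b⟩, rfl⟩ := (sig (m := fun _ : Fin n => m)).surjective b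
      simp only [Set.mem_range, Set.mem_ofPred_eq, foldMap, Equiv.symm_apply_apply]
      constructor
      · rintro ⟨a, h⟩; cases (sig (m := fun _ : Fin n => m)).injective h; rfl
      · rintro rfl; exact ⟨i, rfl⟩)

variable (X Y : Operad.{u} FinCat)

/-- The generators of the tensor product: the elements of `X` and of `Y`. -/
abbrev bvGen (n : FinCat) : Type u := X.obj n ⊕ Y.obj n

/-- The relations of the Boardman–Vogt tensor product: those of the coproduct of `X` and `Y`
(compositions and units of `X` and of `Y`), and the interchange relation
`μ^ν(y, …, y; x) = μ^σ(x, …, x; y)`, that is `x(y, …, y) = y(x, …, x) · shuffle`. -/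
inductive BVRel : ∀ n : FinCat, Term (bvGen X Y) n → Term (bvGen X Y) n → Prop
  | left_mu {T S : FinCat} (f : T ⟶ S) (ε : ∀ i, X.obj (fib f i)) (z : X.obj S) :
      BVRel T (.mu f (fib f) (fun _ => rfl) (fun i => .gen (.inl (ε i))) (.gen (.inl z)))
        (.gen (.inl (X.mu f (fib f) (fun _ => rfl) ε z)))
  | left_one (U : FinCat) (hU : triv U = U) : BVRel U (.gen (.inl (X.one U hU))) (.one U hU)
  | right_mu {T S : FinCat} (f : T ⟶ S) (ε : ∀ i, Y.obj (fib f i)) (z : Y.obj S) :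
      BVRel T (.mu f (fib f) (fun _ => rfl) (fun i => .gen (.inr (ε i))) (.gen (.inr z)))
        (.gen (.inr (Y.mu f (fib f) (fun _ => rfl) ε z)))
  | right_one (U : FinCat) (hU : triv U = U) : BVRel U (.gen (.inr (Y.one U hU))) (.one U hU)
  | interchange {n m : ℕ} (x : X.obj ⟨n⟩) (y : Y.obj ⟨m⟩) :
      BVRel ⟨∑ _ : Fin n, m⟩
        (.mu (blockMap fun _ : Fin n => m) (fun _ => ⟨m⟩) (fib_blockMap _)
          (fun _ => .gen (.inr y)) (.gen (.inl x)))
        (.mu (foldMap n m) (fun _ => ⟨n⟩) (fib_foldMap n m)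
          (fun _ => .gen (.inl x)) (.gen (.inr y)))

/-- The Boardman–Vogt tensor product of two `Fin`-operads. -/
noncomputable def bvTensor : Operad.{u} FinCat := presented (bvGen X Y) (BVRel X Y)

/-- The canonical morphism `X ⟶ X ⊗ Y`. -/
noncomputable def bvInl : X ⟶ bvTensor X Y where
  app x := cls _ (.gen (.inl x))
  map_mu f ε z := ((qmu_cls (bvGen X Y) (BVRel X Y) f _ _
    (fun i => .gen (.inl (ε i))) _).trans (cls_eq _ _ (.of (.left_mu f ε z)))).symm
  map_one U hU := cls_eq _ _ (.of (.left_one U hU))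

/-- The canonical morphism `Y ⟶ X ⊗ Y`. -/
noncomputable def bvInr : Y ⟶ bvTensor X Y where
  app y := cls _ (.gen (.inr y))
  map_mu f ε z := ((qmu_cls (bvGen X Y) (BVRel X Y) f _ _
    (fun i => .gen (.inr (ε i))) _).trans (cls_eq _ _ (.of (.right_mu f ε z)))).symm
  map_one U hU := cls_eq _ _ (.of (.right_one U hU))

end BoardmanVogt

end WreathBV

open WreathBV

universe u

/-! Both operads are given by generators and relations, so a morphism out of either is an assignment
on generators that respects the relations, and two such morphisms agree once they agree on
generators (`presentedLift`, `presented_hom_ext`). It remains to find the two assignments and to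
check that they are mutually inverse.

From the tensor product, send x to [(x; v, …, v)] and y to [(u; y)]. Compositions in X and in Y come
from morphisms of the wreath product that are identities in the other factor. Interchange holds
because both of its sides equal [(x; y, …, y)]: this object maps to (x; v, …, v) with fibres (u; y),
and to (u; y) with fibres (x; v, …, v) (`blockMap_rightGen`, `foldMap_leftGen`).

To the tensor product, send [(x; y₁, …, yₙ)] to μ^ν(y₁, …, yₙ, x). The substance is that a morphism
(x; y) → (z; w) yields a true equation (`blockValue_mu`). Write x as a composite of its fibres ε_t
with z, and each y_s over t as a composite of fibres δ_sq with w_t. Associativity reduces the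
equation to one for each t: composing the δ_sq first with w_t and then with ε_t agrees with
composing them first with ε_t and then with w_t. This is interchange of ε_t and w_t below the matrix
δ (`bv_interchange_matrix`).

On generators the two composites are identities by the unit axioms in one direction, and by
`blockMap_rightGen` in the other. -/

namespace WreathBV
open OperadicCategory
universe w v

/-! ### Fibres in finite sets, and associativity in coordinates -/

namespace FinCat

/-- An order embedding of an ordinal is determined by its range, so `a` and `b` are the canonical
fibre inclusions, and injectivity of `b` leaves only one candidate for the induced map. This allows
fibres to be described by convenient ordinals such as ordinal sums; the comparison is heterogeneous
because those ordinals equal the canonical fibres only propositionally. -/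
theorem fibMap_heq {T S R A B : FinCat} (f : T ⟶ S) (g : S ⟶ R) (h : T ⟶ R) (e : f ≫ g = h)
    (i : Fin R.len) (k : A ⟶ B) (a : Fin A.len ↪o Fin T.len) (ha : Set.range a = {c | h c = i})
    (b : Fin B.len ↪o Fin S.len) (hb : Set.range b = {c | g c = i})
    (hk : ∀ c, b (k c) = f (a c)) : fibMap f g h e i ≍ k := by
  have h1 := orderEmb_unique (fiberEmb h i) a ((range_fiberEmb h i).trans ha.symm)
  have h2 := orderEmb_unique (fiberEmb g i) b ((range_fiberEmb g i).trans hb.symm)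
  refine hom_heq (fiber_eq h i a ha) (fiber_eq g i b hb) _ _ fun c d hcd => ?_
  have h3 : b (Fin.cast h2.1 (fiberMap f g h e i c)) = b (k d) := by
    rw [← h2.2 _ _ rfl, fiberEmb_fiberMap, h1.2 c d hcd, hk]
  exact congrArg Fin.val (b.injective h3)

end FinCat

namespace Operad

theorem Hom.map_mu' {O : Type u} [OperadicCategory.{v} O] {P Q : Operad.{w} O} (α : Hom P Q)
    {T S : O} (f : T ⟶ S) (F : Fin (card S) → O) (hF : ∀ i, fib f i = F i)
    (ε : ∀ i, P.obj (F i)) (z : P.obj S) :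
    α.app (P.mu f F hF ε z) = Q.mu f F hF (fun i => α.app (ε i)) (α.app z) := by
  obtain rfl : fib f = F := funext hF
  exact α.map_mu f ε z

/-- Associativity, with the fibres of `g` and of `f ≫ g` described by order embeddings. -/
theorem assoc_chart (P : Operad.{w} FinCat) {T S R : FinCat} (f : T ⟶ S) (g : S ⟶ R) (h : T ⟶ R)
    (e : f ≫ g = h) (F : Fin S.len → FinCat) (hF : ∀ i, fib f i = F i)
    (G : Fin R.len → FinCat) (hG : ∀ i, fib g i = G i)
    (H : Fin R.len → FinCat) (hH : ∀ i, fib h i = H i)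
    (ε : ∀ i, P.obj (F i)) (δ : ∀ i, P.obj (G i)) (z : P.obj R)
    (a : ∀ i, Fin (H i).len ↪o Fin T.len) (ha : ∀ i, Set.range (a i) = {c | h c = i})
    (b : ∀ i, Fin (G i).len ↪o Fin S.len) (hb : ∀ i, Set.range (b i) = {c | g c = i})
    (k : ∀ i, H i ⟶ G i) (hk : ∀ i c, b i (k i c) = f (a i c))
    (E : ∀ i, Fin (G i).len → FinCat) (hE : ∀ i j, fib (k i) j = E i j)
    (ε' : ∀ i j, P.obj (E i j)) (hε : ∀ i j, ε (b i j) ≍ ε' i j) :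
    P.mu f F hF ε (P.mu g G hG δ z) =
      P.mu h H hH (fun i => P.mu (k i) (E i) (hE i) (ε' i) (δ i)) z := by
  refine P.assoc' f g h e F hF G hG ε δ z H hH _ fun i => ?_
  refine P.mu_congr (FinCat.fiber_eq h i _ (ha i)) (FinCat.fiber_eq g i _ (hb i)) _ _
    (FinCat.fibMap_heq f g h e i (k i) _ (ha i) _ (hb i) (hk i)) _ _ _ _ _ _ (fun j j' hj => ?_)
    _ _ (cast_heq _ _)
  -- Equal ranges force the canonical inclusion and the chart to agree at equal positions.
  have h1 : emb g i j = b i j' :=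
    (orderEmb_unique (FinCat.fiberEmb g i) (b i)
      ((FinCat.range_fiberEmb g i).trans (hb i).symm)).2 j j' hj
  refine HEq.trans ?_ (hε i j')
  rw [h1]

end Operad

/-! ### Morphisms out of a presented operad -/

section Lift
variable {E : FinCat → Type w} {r : ∀ n : FinCat, Term E n → Term E n → Prop}

/-- The value of a formal composite under an assignment of the generators. -/
def Term.eval (Q : Operad.{w} FinCat) (φ : ∀ n, E n → Q.obj n) :
    ∀ {n : FinCat}, Term E n → Q.obj n
  | _, .gen e => φ _ e
  | _, .one U h => Q.one U h
  | _, .mu f F hF ε z => Q.mu f F hF (fun i => (ε i).eval Q φ) (z.eval Q φ)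

/-- Equality of values is itself a congruence on formal composites, and it contains the operad
axioms because `Q` is an operad; hence it contains the congruence generated by `r`. -/
theorem Rel.eval_eq {Q : Operad.{w} FinCat} {φ : ∀ n, E n → Q.obj n}
    (hφ : ∀ n s t, r n s t → s.eval Q φ = t.eval Q φ) {n : FinCat} {s t : Term E n}
    (h : Rel r s t) : s.eval Q φ = t.eval Q φ := by
  induction h with
  | of h => exact hφ _ _ _ h
  | refl => rfl
  | symm _ ih => exact ih.symm
  | trans _ _ ih ih' => exact ih.trans ih'
  | mu_congr f F hF _ _ ih ih' => simp only [Term.eval, ih, ih']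
  | mu_one x => exact Q.mu_one _
  | one_mu f h x => exact Q.one_mu f h _
  | assoc f g ε δ z => exact Q.assoc f g _ _ _

/-- The morphism out of a presented operad given by values of the generators that satisfy the
relations. -/
def presentedLift (Q : Operad.{w} FinCat) (φ : ∀ n, E n → Q.obj n)
    (hφ : ∀ n s t, r n s t → s.eval Q φ = t.eval Q φ) : presented E r ⟶ Q where
  app := Quotient.lift (Term.eval Q φ) fun _ _ h => Rel.eval_eq hφ h
  map_mu f ε z := by
    obtain ⟨z, rfl⟩ := Quotient.exists_rep z
    -- Representatives of the whole family are chosen at once, so that `qmu_cls` applies.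
    obtain ⟨ε, rfl⟩ : ∃ ε', ε = fun i => cls r (ε' i) :=
      ⟨fun i => (ε i).out, funext fun i => (Quotient.out_eq _).symm⟩
    exact congrArg (Quotient.lift (Term.eval Q φ) fun _ _ h => Rel.eval_eq hφ h)
      (qmu_cls E r f _ _ ε z)
  map_one _ _ := rfl

/-- Every element is the class of a formal composite, and morphisms preserve units and structure
maps, so induction on the composite reduces to the generators. -/
theorem presented_hom_ext {Q : Operad.{w} FinCat} {α β : presented E r ⟶ Q}
    (h : ∀ n (e : E n), Operad.Hom.app α (cls r (.gen e)) = Operad.Hom.app β (cls r (.gen e))) :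
    α = β := by
  have key : ∀ n (t : Term E n), Operad.Hom.app α (cls r t) = Operad.Hom.app β (cls r t) := by
    intro n t
    induction t with
    | gen e => exact h _ e
    | one U hU => exact (Operad.Hom.map_one α U hU).trans (Operad.Hom.map_one β U hU).symm
    | mu f F hF ε z ih ih' =>
      rw [← qmu_cls]
      refine (Operad.Hom.map_mu' α f F hF _ _).trans
        (Eq.trans ?_ (Operad.Hom.map_mu' β f F hF _ _).symm)
      rw [ih']
      exact congrArg (fun q => Q.mu f F hF q _) (funext ih)
  refine Operad.Hom.ext (funext fun n => funext fun t => ?_)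
  obtain ⟨t, rfl⟩ := Quotient.exists_rep t
  exact key n t

theorem presented_mu {S T : FinCat} (f : S ⟶ T) (F : Fin T.len → FinCat)
    (hF : ∀ i, fib f i = F i) (ε : ∀ i, Term E (F i)) (z : Term E T) :
    (presented E r).mu f F hF (fun i => cls r (ε i)) (cls r z) = cls r (.mu f F hF ε z) :=
  qmu_cls E r f F hF ε z

end Lift

/-! ### The defining relations of 𝔸(O) -/

section Reflection
variable {O : Type u} [OperadicCategory.{v} O] [IsConnected O]

/-- This is the defining relation with arities and fibres allowed to be merely propositionally equal
to those that `f` produces. The slack is needed because, for instance, (x; v, …, v) has cardinality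
1 + ⋯ + 1 rather than n on the nose. -/
theorem reflect_mu {T S : O} (f : T ⟶ S)
    {n m : FinCat} (hn : card T = n.len) (hm : card S = m.len) (φ : n ⟶ m)
    (hφ : ∀ (a : Fin (card T)) (b : Fin n.len), (a : ℕ) = b → (cardMap f a : ℕ) = φ b)
    (F : Fin m.len → FinCat) (hF : ∀ i, fib φ i = F i) (G : Fin m.len → O)
    (hG : ∀ (i : Fin (card S)) (j : Fin m.len), (i : ℕ) = j → fib f i = G j)
    (hc : ∀ i, card (G i) = (F i).len) :
    (reflect O).mu φ F hF (fun i => reflect.gen (G i) (F i) (hc i)) (reflect.gen S m hm) =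
      reflect.gen T n hn := by
  obtain ⟨n⟩ := n
  obtain ⟨m⟩ := m
  dsimp only at hn hm
  subst hn hm
  obtain rfl : cardHom f = φ := funext fun a => Fin.ext (hφ a a rfl)
  obtain rfl : fib f = G := funext fun i => hG i i rfl
  obtain rfl : (fun i => ⟨card (fib f i)⟩) = F := funext fun i => congrArg FinCat.mk (hc i)
  exact (presented_mu _ _ _ _ _).trans
    (cls_eq _ _ (.of (.mu (P := Operad.terminal.{0} O) f (fun _ => ⟨⟩) ⟨⟩)))

theorem reflect_one {U : O} (hU : triv U = U) (h : card U = 1) :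
    reflect.gen U ⟨1⟩ h = (reflect O).one ⟨1⟩ rfl :=
  cls_eq _ _ (.of (.one (P := Operad.terminal.{0} O) U hU))

end Reflection

/-! ### Rows and columns of an ordinal sum -/

/-- The order embedding of the `s`-th summand into an ordinal sum. -/
def inBlock {n : ℕ} (m : Fin n → ℕ) (s : Fin n) : Fin (m s) ↪o Fin (∑ i, m i) :=
  OrderEmbedding.ofStrictMono (fun b => sig ⟨s, b⟩)
    fun _ _ h => sig_lt_of_lex _ _ (Or.inr ⟨rfl, h⟩)

theorem range_inBlock {n : ℕ} (m : Fin n → ℕ) (s : Fin n) :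
    Set.range (inBlock m s) = {c | blockMap m c = s} := by
  ext b
  obtain ⟨⟨j, b⟩, rfl⟩ := sig.surjective b
  simp only [Set.mem_range, Set.mem_ofPred_eq, blockMap, Equiv.symm_apply_apply, inBlock]
  constructor
  · rintro ⟨a, h⟩; exact (congrArg Sigma.fst (sig.injective h)).symm
  · rintro rfl; exact ⟨b, rfl⟩

/-- The order embedding `n → m ⊕ ⋯ ⊕ m` that selects the `b`-th element of each summand. -/
def acrossBlocks (n : ℕ) {m : ℕ} (b : Fin m) : Fin n ↪o Fin (∑ _ : Fin n, m) :=
  OrderEmbedding.ofStrictMono (fun s => sig (m := fun _ : Fin n => m) ⟨s, b⟩)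
    fun _ _ h => sig_lt_of_lex _ _ (Or.inl h)

theorem range_acrossBlocks (n : ℕ) {m : ℕ} (b : Fin m) :
    Set.range (acrossBlocks n b) = {c | foldMap n m c = b} := by
  ext c
  obtain ⟨⟨i, c⟩, rfl⟩ := (sig (m := fun _ : Fin n => m)).surjective c
  simp only [Set.mem_range, Set.mem_ofPred_eq, foldMap, Equiv.symm_apply_apply, acrossBlocks]
  constructor
  · rintro ⟨a, h⟩; cases (sig (m := fun _ : Fin n => m)).injective h; rfl
  · rintro rfl; exact ⟨i, rfl⟩

/-! ### Interchange in the tensor product -/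

section Interchange
variable (X Y : Operad.{u} FinCat)

theorem bv_interchange {n m : ℕ} (x : X.obj ⟨n⟩) (y : Y.obj ⟨m⟩) :
    (bvTensor X Y).mu (blockMap fun _ : Fin n => m) (fun _ => ⟨m⟩) (fib_blockMap _)
      (fun _ => Operad.Hom.app (bvInr X Y) y) (Operad.Hom.app (bvInl X Y) x) =
    (bvTensor X Y).mu (foldMap n m) (fun _ => ⟨n⟩) (fib_foldMap n m)
      (fun _ => Operad.Hom.app (bvInl X Y) x) (Operad.Hom.app (bvInr X Y) y) :=
  (qmu_cls (bvGen X Y) (BVRel X Y) _ _ _ (fun _ => .gen (.inr y)) (.gen (.inl x))).trans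
    ((cls_eq _ _ (.of (.interchange x y))).trans
      (qmu_cls (bvGen X Y) (BVRel X Y) _ _ _ (fun _ => .gen (.inl x)) (.gen (.inr y))).symm)

/-- Interchange of `x` and `y` after a further composition with a matrix of operations `δ`. -/
theorem bv_interchange_matrix {n m : ℕ} (x : X.obj ⟨n⟩) (y : Y.obj ⟨m⟩) {K : FinCat}
    (ν : K ⟶ ⟨n⟩) (g : K ⟶ ⟨m⟩) (A : Fin n → FinCat) (B : Fin m → FinCat)
    (hA : ∀ s, fib ν s = A s) (hB : ∀ b, fib g b = B b)
    (a : ∀ s, Fin (A s).len ↪o Fin K.len) (ha : ∀ s, Set.range (a s) = {c | ν c = s})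
    (b : ∀ t, Fin (B t).len ↪o Fin K.len) (hb : ∀ t, Set.range (b t) = {c | g c = t})
    (k : ∀ s, A s ⟶ ⟨m⟩) (hk : ∀ s c, k s c = g (a s c))
    (l : ∀ t, B t ⟶ ⟨n⟩) (hl : ∀ t c, l t c = ν (b t c))
    (D : Fin n → Fin m → FinCat) (hD : ∀ s t, fib (k s) t = D s t)
    (hD' : ∀ t s, fib (l t) s = D s t) (δ : ∀ s t, (bvTensor X Y).obj (D s t)) :
    (bvTensor X Y).mu ν A hA (fun s => (bvTensor X Y).mu (k s) (D s) (hD s) (δ s)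
        (Operad.Hom.app (bvInr X Y) y)) (Operad.Hom.app (bvInl X Y) x) =
    (bvTensor X Y).mu g B hB (fun t => (bvTensor X Y).mu (l t) (fun s => D s t) (hD' t)
        (fun s => δ s t) (Operad.Hom.app (bvInl X Y) x)) (Operad.Hom.app (bvInr X Y) y) := by
  let σ : (Σ _ : Fin n, Fin m) ≃ Fin (∑ _ : Fin n, m) := sig (m := fun _ : Fin n => m)
  have haν : ∀ s c, ν (a s c) = s := fun s c => by
    have : a s c ∈ Set.range (a s) := ⟨_, rfl⟩
    rwa [ha] at this
  have hbg : ∀ t c, g (b t c) = t := fun t c => by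
    have : b t c ∈ Set.range (b t) := ⟨_, rfl⟩
    rwa [hb] at this
  -- `G` is the pair (ν, g), with n × m ordered lexicographically. Both sides turn out to be μ^G of
  -- δ and one of the two sides of the plain interchange relation.
  let G : K ⟶ ⟨∑ _ : Fin n, m⟩ := fun c => σ ⟨ν c, g c⟩
  -- The fibre of `G` over (s, t) is the fibre of `k s` over t, included into `K` through `A s`.
  have hF : ∀ q, fib G q = D (σ.symm q).1 (σ.symm q).2 := by
    intro q
    obtain ⟨⟨s, t⟩, rfl⟩ := σ.surjective q
    rw [Equiv.symm_apply_apply, ← hD]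
    refine FinCat.fiber_eq G _ ((FinCat.fiberEmb (k s) t).trans (a s)) ?_
    ext c
    simp only [Set.mem_range, RelEmbedding.coe_trans, Function.comp, Set.mem_ofPred_eq]
    constructor
    · rintro ⟨d, rfl⟩
      have h1 := haν s (FinCat.fiberEmb (k s) t d)
      have h2 := FinCat.fiberEmb_mem (k s) t d
      rw [hk] at h2
      simp only [G, h1, h2]
    · intro h
      have h1 := σ.injective h
      have h2 : ν c = s := congrArg Sigma.fst h1
      have h3 : g c = t := congrArg (fun p : (Σ _ : Fin n, Fin m) => p.2) h1
      have h4 : c ∈ Set.range (a s) := by rw [ha]; exact h2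
      obtain ⟨d, rfl⟩ := h4
      have h5 : d ∈ Set.range (FinCat.fiberEmb (k s) t) := by
        rw [FinCat.range_fiberEmb]; exact (hk s d).trans h3
      obtain ⟨d, rfl⟩ := h5
      exact ⟨d, rfl⟩
  have hδ : ∀ p q : (Σ _ : Fin n, Fin m), p = q → δ p.1 p.2 ≍ δ q.1 q.2 := by
    rintro p _ rfl; rfl
  -- Since ν is `G` followed by the row projection, associativity gathers all of δ below μ^ν(y, …,
  -- y, x).
  refine ((bvTensor X Y).assoc_chart G (blockMap fun _ : Fin n => m) ν ?_ _ hF (fun _ => ⟨m⟩)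
    (fib_blockMap _) A hA (fun q => δ (σ.symm q).1 (σ.symm q).2) _ _ a ha
    (inBlock fun _ : Fin n => m) (range_inBlock _) k ?_ D hD δ ?_).symm.trans ?_
  · funext c
    exact congrArg Sigma.fst (σ.symm_apply_apply ⟨ν c, g c⟩)
  · intro s c
    exact congrArg σ (Sigma.ext (haν s c).symm (heq_of_eq (hk s c)))
  · intro s t
    exact hδ _ ⟨s, t⟩ (σ.symm_apply_apply ⟨s, t⟩)
  refine (congrArg ((bvTensor X Y).mu G _ hF _) (bv_interchange X Y x y)).trans ?_
  -- After the interchange, `g` is `G` followed by the column projection, so associativity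
  -- distributes δ over the columns.
  refine (bvTensor X Y).assoc_chart G (foldMap n m) g ?_ _ hF (fun _ => ⟨n⟩) (fib_foldMap n m)
    B hB (fun q => δ (σ.symm q).1 (σ.symm q).2) _ _ b hb (fun t => acrossBlocks n t)
    (range_acrossBlocks n) l ?_ (fun t s => D s t) hD' (fun t s => δ s t) ?_
  · funext c
    exact congrArg (fun p : (Σ _ : Fin n, Fin m) => p.2) (σ.symm_apply_apply ⟨ν c, g c⟩)
  · intro t c
    exact congrArg σ (Sigma.ext (hl t c) (heq_of_eq (hbg t c).symm))
  · intro t s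
    exact hδ _ ⟨s, t⟩ (σ.symm_apply_apply ⟨s, t⟩)

end Interchange

/-- The map of disjoint unions induced by a map of the index sets and maps of the summands. -/
def sigmaEmb {n n' : ℕ} {m : Fin n → ℕ} {m' : Fin n' → ℕ} (e : Fin n' ↪o Fin n)
    (g : ∀ s, Fin (m' s) ↪o Fin (m (e s))) (p : Σ s, Fin (m' s)) : Σ i, Fin (m i) :=
  ⟨e p.1, g p.1 p.2⟩

/-- The order embedding of ordinal sums induced by an order embedding of the index sets and order
embeddings of the summands. -/
def sumEmb {n n' : ℕ} {m : Fin n → ℕ} {m' : Fin n' → ℕ} (e : Fin n' ↪o Fin n)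
    (g : ∀ s, Fin (m' s) ↪o Fin (m (e s))) : Fin (∑ s, m' s) ↪o Fin (∑ i, m i) :=
  OrderEmbedding.ofStrictMono (fun c => sig (sigmaEmb e g (sig.symm c))) fun c d h => by
    obtain ⟨⟨s, c⟩, rfl⟩ := sig.surjective c
    obtain ⟨⟨t, d⟩, rfl⟩ := sig.surjective d
    simp only [Equiv.symm_apply_apply]
    rcases lex_of_sig_lt _ _ h with h | ⟨h, h'⟩
    · exact sig_lt_of_lex _ _ (Or.inl (e.strictMono h))
    · dsimp only at h h'
      subst h
      exact sig_lt_of_lex _ _ (Or.inr ⟨rfl, (g s).strictMono h'⟩)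

theorem sumEmb_sig {n n' : ℕ} {m : Fin n → ℕ} {m' : Fin n' → ℕ} (e : Fin n' ↪o Fin n)
    (g : ∀ s, Fin (m' s) ↪o Fin (m (e s))) (s : Fin n') (c : Fin (m' s)) :
    sumEmb e g (sig ⟨s, c⟩) = sig ⟨e s, g s c⟩ :=
  congrArg (fun p => sig (sigmaEmb e g p)) (sig.symm_apply_apply ⟨s, c⟩)

theorem blockMap_sig {n : ℕ} (m : Fin n → ℕ) (p : Σ i, Fin (m i)) : blockMap m (sig p) = p.1 :=
  congrArg Sigma.fst (sig.symm_apply_apply p)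

/-! ### Block composites respect the morphisms of the wreath product -/

section Value
variable {X Y : Operad.{u} FinCat}

variable (X Y) in
/-- The composite `μ^ν(y₁, …, yₙ, x)` in the tensor product. -/
noncomputable def blockValue (x : Wreath (Groth X) (Groth Y)) : (bvTensor X Y).obj ⟨card x⟩ :=
  (bvTensor X Y).mu (blockMap fun i => card (x.elt i)) (fun i => (x.elt i).base)
    (fib_blockMap _) (fun i => Operad.Hom.app (bvInr X Y) (x.elt i).elt)
    (Operad.Hom.app (bvInl X Y) x.base.elt)

/-- The cardinality of `x` maps to that of `z.base` through the cardinality of `z` and also through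
that of `x.base`. Associativity along the two routes writes both sides as composites over the same
map `h` with the same outer operation `z.base.elt`. The inner operations over each t then differ by
the interchange of `f.base.elt t` with `(z.elt t).elt`. -/
theorem blockValue_mu {x z : Wreath (Groth X) (Groth Y)} (f : x ⟶ z) :
    (bvTensor X Y).mu (cardHom f) (fun q => ⟨card (fib f q)⟩) (fib_cardHom f)
      (fun q => blockValue X Y (fib f q)) (blockValue X Y z) = blockValue X Y x := by
  let φ : x.base.base ⟶ z.base.base := f.base.base
  let ψ : ∀ (t : Fin (card z.base)) (s : Fin (card (fib f.base t))),
      x.elt (emb f.base t s) ⟶ z.elt t := fun t s => f.elt _ t (cardMap_emb f.base t s)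
  let H : Fin (card z.base) → FinCat := fun t => ⟨∑ s, card (x.elt (emb f.base t s))⟩
  -- The common composite of the two routes; `H t` is its fibre over t.
  let h : (⟨card x⟩ : FinCat) ⟶ z.base.base := fun c => cardMap f.base (sig.symm c).1
  have h_sig : ∀ i (c : Fin (card (x.elt i))), h (sig ⟨i, c⟩) = cardMap f.base i := fun i c =>
    congrArg (cardMap f.base) (blockMap_sig (fun i => card (x.elt i)) ⟨i, c⟩)
  -- `k t` below is the restriction of |f| to the fibre `H t`, with values in the t-th summand of
  -- |z|; `κ` is the same map before summands are numbered.
  let κ : ∀ t, (Σ s, Fin (card (x.elt (emb f.base t s)))) → Fin (card (z.elt t)) :=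
    fun t p => cardMap (ψ t p.1) p.2
  let k : ∀ t, H t ⟶ (z.elt t).base := fun t c => κ t (sig.symm c)
  have k_sig : ∀ t s (c : Fin (card (x.elt (emb f.base t s)))),
      k t (sig ⟨s, c⟩) = cardMap (ψ t s) c := fun t s c =>
    congrArg (κ t) ((sig (m := fun s => card (x.elt (emb f.base t s)))).symm_apply_apply ⟨s, c⟩)
  let a : ∀ t, Fin (H t).len ↪o Fin (card x) := fun t =>
    sumEmb (emb f.base t) fun _ => RelEmbedding.refl _
  have a_sig : ∀ t s (c : Fin (card (x.elt (emb f.base t s)))),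
      a t (sig ⟨s, c⟩) = sig ⟨emb f.base t s, c⟩ := fun t s c =>
    sumEmb_sig (m := fun i => card (x.elt i)) (m' := fun s => card (x.elt (emb f.base t s)))
      (emb f.base t) (fun _ => RelEmbedding.refl _) s c
  have ha : ∀ t, Set.range (a t) = {c | h c = t} := by
    intro t
    ext c
    obtain ⟨⟨i, c⟩, rfl⟩ := sig.surjective c
    rw [Set.mem_ofPred_eq, h_sig]
    constructor
    · rintro ⟨d, hd⟩
      obtain ⟨⟨s, d⟩, rfl⟩ := sig.surjective d
      rw [a_sig] at hd
      obtain rfl : emb f.base t s = i := congrArg Sigma.fst (sig.injective hd)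
      exact cardMap_emb f.base t s
    · intro hi
      have : i ∈ Set.range (emb f.base t) := by rw [range_emb]; exact hi
      obtain ⟨s, rfl⟩ := this
      exact ⟨sig ⟨s, c⟩, a_sig t s c⟩
  have hH : ∀ t, fib h t = H t := fun t => FinCat.fiber_eq h t (a t) (ha t)
  -- The fibre of `k t` over q is the ordinal sum, over s, of the fibres of `ψ t s` over q:
  -- precisely the cardinality of the wreath fibre of `f` over (t, q).
  let b : ∀ t (q : Fin (card (z.elt t))), Fin (card (Wreath.fibre f ⟨t, q⟩)) ↪o Fin (H t).len :=
    fun t q => sumEmb (RelEmbedding.refl _) fun s => emb (ψ t s) q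
  have b_sig : ∀ t q s (c : Fin (card (fib (ψ t s) q))),
      b t q (sig ⟨s, c⟩) = sig ⟨s, emb (ψ t s) q c⟩ := fun t q s c =>
    sumEmb_sig (m := fun s => card (x.elt (emb f.base t s))) (m' := fun s => card (fib (ψ t s) q))
      (RelEmbedding.refl _) (fun s => emb (ψ t s) q) s c
  have hb : ∀ t q, Set.range (b t q) = {c | k t c = q} := by
    intro t q
    ext c
    obtain ⟨⟨s, c⟩, rfl⟩ := sig.surjective c
    rw [Set.mem_ofPred_eq, k_sig]
    constructor
    · rintro ⟨d, hd⟩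
      obtain ⟨⟨s', d⟩, rfl⟩ := sig.surjective d
      have hd' := sig.injective ((b_sig t q s' d).symm.trans hd)
      obtain rfl : s' = s := congrArg Sigma.fst hd'
      obtain rfl : emb (ψ t s') q d = c := eq_of_heq (Sigma.mk.inj hd').2
      exact cardMap_emb (ψ t s') q d
    · intro hc
      have : c ∈ Set.range (emb (ψ t s) q) := by rw [range_emb]; exact hc
      obtain ⟨d, rfl⟩ := this
      exact ⟨sig ⟨s, d⟩, b_sig t q s d⟩
  have hE : ∀ t q, fib (k t) q = ⟨card (Wreath.fibre f ⟨t, q⟩)⟩ := fun t q =>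
    FinCat.fiber_eq (k t) q (b t q) (hb t q)
  have hx : Operad.Hom.app (bvInl X Y) x.base.elt = (bvTensor X Y).mu φ (fib φ) (fun _ => rfl)
      (fun t => Operad.Hom.app (bvInl X Y) (f.base.elt t))
      (Operad.Hom.app (bvInl X Y) z.base.elt) := by
    rw [← f.base.mu_eq]
    exact Operad.Hom.map_mu _ _ _ _
  have hy : ∀ t s, Operad.Hom.app (bvInr X Y) (x.elt (emb f.base t s)).elt =
      (bvTensor X Y).mu (ψ t s).base (fib (ψ t s).base) (fun _ => rfl)
      (fun q => Operad.Hom.app (bvInr X Y) ((ψ t s).elt q))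
      (Operad.Hom.app (bvInr X Y) (z.elt t).elt) := by
    intro t s
    rw [← (ψ t s).mu_eq]
    exact Operad.Hom.map_mu _ _ _ _
  -- Needed because `sig.symm (sig p)` is only propositionally `p`, while the arity of the value
  -- depends on it.
  have hv : ∀ p q : z.Index, p = q →
      blockValue X Y (Wreath.fibre f p) ≍ blockValue X Y (Wreath.fibre f q) := by
    rintro p _ rfl; rfl
  -- The route through the cardinality of `z`, for the side with the fibres of `f`.
  refine ((bvTensor X Y).assoc_chart (cardHom f) (blockMap fun t => card (z.elt t)) h ?_ _ _
    (fun t => (z.elt t).base) (fib_blockMap _) H hH _ _ _ a ha _ (range_inBlock _) k ?_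
    (fun t q => ⟨card (Wreath.fibre f ⟨t, q⟩)⟩) hE
    (fun t q => blockValue X Y (Wreath.fibre f ⟨t, q⟩)) ?_).trans (Eq.symm ?_)
  · funext c
    obtain ⟨⟨i, c⟩, rfl⟩ := sig.surjective c
    exact (blockMap_sig _ _).trans (congrArg (fun p => cardMap f.base (Sigma.fst p)) rfl)
  · intro t c
    obtain ⟨⟨s, c⟩, rfl⟩ := sig.surjective c
    rw [a_sig, k_sig]
    refine (congrArg sig ?_ : sig (⟨t, cardMap (ψ t s) c⟩ : z.Index) = sig _)
    rw [Equiv.symm_apply_apply]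
    exact (Wreath.indexMap_mk f _ _ t (cardMap_emb f.base t s)).symm
  · intro t q
    exact hv _ ⟨t, q⟩ (sig.symm_apply_apply _)
  rw [blockValue, hx]
  -- The route through the cardinality of `x.base`, after the operation of `x.base` has been
  -- decomposed along `φ`.
  refine ((bvTensor X Y).assoc_chart (blockMap fun i => card (x.elt i)) φ h rfl _ _
    (fib φ) (fun _ => rfl) H hH _ _ _ a ha (fun t => emb φ t) (fun t => range_emb φ t)
    (fun t => blockMap fun s => card (x.elt (emb f.base t s))) ?_
    (fun t s => (x.elt (emb f.base t s)).base) (fun t => fib_blockMap _)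
    (fun t s => Operad.Hom.app (bvInr X Y) (x.elt (emb f.base t s)).elt)
    (fun _ _ => HEq.rfl)).trans ?_
  · intro t c
    obtain ⟨⟨s, c⟩, rfl⟩ := sig.surjective c
    rw [a_sig]
    exact (congrArg (emb φ t) (blockMap_sig _ _)).trans
      (blockMap_sig (fun i => card (x.elt i)) ⟨emb f.base t s, c⟩).symm
  refine congrArg (fun ζ => (bvTensor X Y).mu h H hH ζ _) (funext fun t => ?_)
  simp only [hy]
  -- The matrix entry at (s, q) is the q-th fibre of the component `ψ t s`.
  exact bv_interchange_matrix X Y (f.base.elt t) (z.elt t).elt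
    (blockMap fun s => card (x.elt (emb f.base t s))) (k t)
    (fun s => (x.elt (emb f.base t s)).base) (fun q => ⟨card (Wreath.fibre f ⟨t, q⟩)⟩)
    (fib_blockMap _) (hE t) (inBlock _) (range_inBlock _) (b t) (hb t)
    (fun s => (ψ t s).base) (fun s c => (k_sig t s c).symm)
    (fun q => blockMap fun s => card (fib (ψ t s) q))
    (fun q c => by
      obtain ⟨⟨s, c⟩, rfl⟩ := sig.surjective c
      exact (blockMap_sig _ _).trans ((congrArg _ (b_sig t q s c)).trans (blockMap_sig _ _)).symm)
    (fun s q => fib (ψ t s).base q) (fun _ _ => rfl) (fun q => fib_blockMap _)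
    (fun s q => Operad.Hom.app (bvInr X Y) ((ψ t s).elt q))

end Value

/-! ### Ordinal sums of one-point summands, and of a single summand -/

theorem sig_val_of_one {n : ℕ} {m : Fin n → ℕ} (hm : ∀ i, m i = 1) (p : Σ i, Fin (m i)) :
    (sig p : ℕ) = p.1 := by
  have := p.2.2
  have := hm p.1
  simp only [sig, finSigmaFinEquiv_apply, hm, Finset.sum_const, Finset.card_univ, Fintype.card_fin,
    smul_eq_mul]
  omega

theorem sig_symm_fst_val {n : ℕ} {m : Fin n → ℕ} (hm : ∀ i, m i = 1) (a : Fin (∑ i, m i)) :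
    ((sig.symm a).1 : ℕ) = a := by
  rw [← sig_val_of_one hm, Equiv.apply_symm_apply]

theorem sig_val_fin_one {m : Fin 1 → ℕ} (p : Σ i, Fin (m i)) : (sig p : ℕ) = p.2 := by
  obtain ⟨i, a⟩ := p
  obtain rfl : i = 0 := Subsingleton.elim _ _
  simp [sig, finSigmaFinEquiv_apply]

theorem sig_symm_snd_val {m : Fin 1 → ℕ} (a : Fin (∑ i, m i)) : ((sig.symm a).2 : ℕ) = a := by
  rw [← sig_val_fin_one, Equiv.apply_symm_apply]

/-! ### The classes [(x; v, …, v)] and [(u; y)] and their relations -/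

section Generators
variable {X Y : Operad.{u} FinCat}

/-- The class `[(x; v, …, v)]`. -/
noncomputable def leftGen (Y : Operad.{u} FinCat) {n : FinCat} (x : X.obj n) :
    (reflect (Wreath (Groth X) (Groth Y))).obj n :=
  reflect.gen (O := Wreath (Groth X) (Groth Y)) ⟨⟨n, x⟩, fun _ => ⟨⟨1⟩, Y.one ⟨1⟩ rfl⟩⟩ n
    ((Finset.sum_const 1).trans (by simp [card]))

/-- The class `[(u; y)]`. -/
noncomputable def rightGen (X : Operad.{u} FinCat) {m : FinCat} (y : Y.obj m) :
    (reflect (Wreath (Groth X) (Groth Y))).obj m :=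
  reflect.gen (O := Wreath (Groth X) (Groth Y)) ⟨⟨⟨1⟩, X.one ⟨1⟩ rfl⟩, fun _ => ⟨m, y⟩⟩ m
    (Fin.sum_univ_one _)

/-- The relation comes from the morphism (f, ε) with identities on every v; its fibre over i is
(ε_i; v, …, v), because the fibres of an identity are units. -/
theorem leftGen_mu {T S : FinCat} (f : T ⟶ S) (ε : ∀ i, X.obj (fib f i)) (z : X.obj S) :
    (reflect (Wreath (Groth X) (Groth Y))).mu f (fib f) (fun _ => rfl)
      (fun i => leftGen Y (ε i)) (leftGen Y z) =
        leftGen Y (X.mu f (fib f) (fun _ => rfl) ε z) := by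
  let F : (⟨⟨T, X.mu f (fib f) (fun _ => rfl) ε z⟩, fun _ => ⟨⟨1⟩, Y.one ⟨1⟩ rfl⟩⟩ :
      Wreath (Groth X) (Groth Y)) ⟶ ⟨⟨S, z⟩, fun _ => ⟨⟨1⟩, Y.one ⟨1⟩ rfl⟩⟩ :=
    Wreath.Hom.mk (Groth.Hom.mk f ε rfl) fun _ _ _ => 𝟙 _
  refine reflect_mu F _ _ f (fun a b hab => ?_) _ _
    (fun i => ⟨⟨fib f i, ε i⟩, fun _ => ⟨⟨1⟩, Y.one ⟨1⟩ rfl⟩⟩) (fun i j hij => ?_) _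
  · refine (sig_val_of_one (fun _ => rfl) _).trans ?_
    exact congrArg (fun c => (f c : ℕ)) (Fin.ext ((sig_symm_fst_val (fun _ => rfl) a).trans hab))
  · obtain rfl : (sig.symm i).1 = j := Fin.ext ((sig_symm_fst_val (fun _ => rfl) i).trans hij)
    exact Wreath.obj_ext rfl fun _ _ _ => (fib_id _ _).symm

/-- Here the morphism is the identity on u together with (f, ε), and its fibre over i is (u; ε_i).
-/
theorem rightGen_mu {T S : FinCat} (f : T ⟶ S) (ε : ∀ i, Y.obj (fib f i)) (z : Y.obj S) :
    (reflect (Wreath (Groth X) (Groth Y))).mu f (fib f) (fun _ => rfl)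
      (fun i => rightGen X (ε i)) (rightGen X z) =
        rightGen X (Y.mu f (fib f) (fun _ => rfl) ε z) := by
  let F : (⟨⟨⟨1⟩, X.one ⟨1⟩ rfl⟩, fun _ => ⟨T, Y.mu f (fib f) (fun _ => rfl) ε z⟩⟩ :
      Wreath (Groth X) (Groth Y)) ⟶ ⟨⟨⟨1⟩, X.one ⟨1⟩ rfl⟩, fun _ => ⟨S, z⟩⟩ :=
    Wreath.Hom.mk (𝟙 _) fun _ _ _ => Groth.Hom.mk f ε rfl
  refine reflect_mu F _ _ f (fun a b hab => ?_) _ _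
    (fun i => ⟨⟨⟨1⟩, X.one ⟨1⟩ rfl⟩, fun _ => ⟨fib f i, ε i⟩⟩) (fun i j hij => ?_) _
  · refine (sig_val_fin_one _).trans ?_
    exact congrArg (fun c => (f c : ℕ)) (Fin.ext ((sig_symm_snd_val a).trans hab))
  · obtain rfl : (sig.symm i).2 = j := Fin.ext ((sig_symm_snd_val i).trans hij)
    exact Wreath.obj_ext (fib_id (⟨⟨1⟩, X.one ⟨1⟩ rfl⟩ : Groth X) _).symm fun _ _ _ => rfl

theorem triv_unit :
    triv (⟨⟨⟨1⟩, X.one ⟨1⟩ rfl⟩, fun _ => ⟨⟨1⟩, Y.one ⟨1⟩ rfl⟩⟩ : Wreath (Groth X) (Groth Y)) =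
      ⟨⟨⟨1⟩, X.one ⟨1⟩ rfl⟩, fun _ => ⟨⟨1⟩, Y.one ⟨1⟩ rfl⟩⟩ :=
  Wreath.obj_ext rfl fun _ _ _ => (point_eq (⟨⟨1⟩, Y.one ⟨1⟩ rfl⟩ : Groth Y)).symm

theorem leftGen_one (U : FinCat) (hU : triv U = U) :
    leftGen Y (X.one U hU) = (reflect (Wreath (Groth X) (Groth Y))).one U hU := by
  obtain rfl : (⟨1⟩ : FinCat) = U := hU
  exact reflect_one triv_unit _

theorem rightGen_one (U : FinCat) (hU : triv U = U) :
    rightGen X (Y.one U hU) = (reflect (Wreath (Groth X) (Groth Y))).one U hU := by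
  obtain rfl : (⟨1⟩ : FinCat) = U := hU
  exact reflect_one triv_unit _

/-- Apply the relation to (x; y₁, …, yₙ) → (x; v, …, v), the identity on x with the unique maps yᵢ →
v. Fibres over v are whole domains, so the i-th fibre is (u; yᵢ). This gives one side of interchange
and also shows that the classes of the two kinds generate. -/
theorem blockMap_rightGen {n : ℕ} (x : X.obj ⟨n⟩) (k : Fin n → ℕ) (y : ∀ i, Y.obj ⟨k i⟩) :
    (reflect (Wreath (Groth X) (Groth Y))).mu (blockMap k) (fun i => ⟨k i⟩) (fib_blockMap k)
      (fun i => rightGen X (y i)) (leftGen Y x) =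
    reflect.gen (O := Wreath (Groth X) (Groth Y)) ⟨⟨⟨n⟩, x⟩, fun i => ⟨⟨k i⟩, y i⟩⟩
      ⟨∑ i, k i⟩ rfl := by
  let F : (⟨⟨⟨n⟩, x⟩, fun i => ⟨⟨k i⟩, y i⟩⟩ : Wreath (Groth X) (Groth Y)) ⟶
      ⟨⟨⟨n⟩, x⟩, fun _ => ⟨⟨1⟩, Y.one ⟨1⟩ rfl⟩⟩ :=
    Wreath.Hom.mk (𝟙 _) fun _ _ _ => toTriv _
  refine reflect_mu F _ _ (blockMap k) (fun a b hab => ?_) _ _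
    (fun i => ⟨⟨⟨1⟩, X.one ⟨1⟩ rfl⟩, fun _ => ⟨⟨k i⟩, y i⟩⟩) (fun i j hij => ?_) _
  · obtain rfl := Fin.ext hab
    exact sig_val_of_one (fun _ => rfl) _
  · obtain rfl : (sig.symm i).1 = j := Fin.ext ((sig_symm_fst_val (fun _ => rfl) i).trans hij)
    refine Wreath.obj_ext (fib_id (⟨⟨n⟩, x⟩ : Groth X) _).symm fun s s' _ => ?_
    refine (fib_triv (O := Groth Y) _ rfl _).trans ?_
    exact congrArg (fun i => (⟨⟨k i⟩, y i⟩ : Groth Y)) (emb_id (⟨⟨n⟩, x⟩ : Groth X) _ _)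

/-- Apply the relation to (x; y, …, y) → (u; y), the unique map x → u with identities on y; each
fibre is (x; v, …, v). This is the other side of interchange. -/
theorem foldMap_leftGen {n m : ℕ} (x : X.obj ⟨n⟩) (y : Y.obj ⟨m⟩) :
    (reflect (Wreath (Groth X) (Groth Y))).mu (foldMap n m) (fun _ => ⟨n⟩) (fib_foldMap n m)
      (fun _ => leftGen Y x) (rightGen X y) =
    reflect.gen (O := Wreath (Groth X) (Groth Y)) ⟨⟨⟨n⟩, x⟩, fun _ => ⟨⟨m⟩, y⟩⟩
      ⟨∑ _ : Fin n, m⟩ rfl := by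
  let F : (⟨⟨⟨n⟩, x⟩, fun _ => ⟨⟨m⟩, y⟩⟩ : Wreath (Groth X) (Groth Y)) ⟶
      ⟨⟨⟨1⟩, X.one ⟨1⟩ rfl⟩, fun _ => ⟨⟨m⟩, y⟩⟩ :=
    Wreath.Hom.mk (toTriv (⟨⟨n⟩, x⟩ : Groth X)) fun _ _ _ => 𝟙 _
  refine reflect_mu F _ _ (foldMap n m) (fun a b hab => ?_) _ _
    (fun _ => ⟨⟨⟨n⟩, x⟩, fun _ => ⟨⟨1⟩, Y.one ⟨1⟩ rfl⟩⟩) (fun i j hij => ?_) _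
  · obtain rfl := Fin.ext hab
    exact sig_val_fin_one _
  · exact Wreath.obj_ext (fib_triv (O := Groth X) _ rfl _) fun _ _ _ => (fib_id _ _).symm

/-! ### The two mutually inverse morphisms -/

/-- The generators `x ↦ [(x; v, …, v)]` and `y ↦ [(u; y)]`. -/
noncomputable def genValue (X Y : Operad.{u} FinCat) (n : FinCat) :
    bvGen X Y n → (reflect (Wreath (Groth X) (Groth Y))).obj n :=
  Sum.elim (leftGen Y) (rightGen X)

variable (X Y) in
/-- The morphism from the tensor product with `x ↦ [(x; v, …, v)]` and `y ↦ [(u; y)]`. -/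
noncomputable def bvToReflect : bvTensor X Y ⟶ reflect (Wreath (Groth X) (Groth Y)) :=
  presentedLift _ (genValue X Y) fun n s t h => by
    cases h with
    | left_mu f ε z => exact leftGen_mu f ε z
    | left_one _ hU => exact leftGen_one _ hU
    | right_mu f ε z => exact rightGen_mu f ε z
    | right_one _ hU => exact rightGen_one _ hU
    | interchange x y => exact (blockMap_rightGen x _ _).trans (foldMap_leftGen x y).symm

/-- The value `μ^ν(y₁, …, yₙ, x)` of the generator `[(x; y₁, …, yₙ)]`. -/
noncomputable def objValue (X Y : Operad.{u} FinCat) (n : FinCat)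
    (p : leftExtGen (Operad.terminal.{0} (Wreath (Groth X) (Groth Y))) n) :
    (bvTensor X Y).obj n :=
  cast (congrArg (fun k => (bvTensor X Y).obj ⟨k⟩) p.2) (blockValue X Y p.1.base)

theorem blockValue_right {m : FinCat} (y : Y.obj m) :
    blockValue X Y ⟨⟨⟨1⟩, X.one ⟨1⟩ rfl⟩, fun _ => ⟨m, y⟩⟩ ≍ Operad.Hom.app (bvInr X Y) y := by
  have h : Operad.Hom.app (bvInl X Y) (X.one ⟨1⟩ rfl) = (bvTensor X Y).one ⟨1⟩ rfl :=
    Operad.Hom.map_one (bvInl X Y) ⟨1⟩ rfl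
  refine (heq_of_eq (congrArg ((bvTensor X Y).mu _ _ _ _) h)).trans ?_
  exact (bvTensor X Y).mu_over_triv rfl _ _ _ _ (0 : Fin 1)

/-- Once 1 + ⋯ + 1 is identified with n, the block map becomes the identity and its fibres carry
units, so the unit axiom applies. -/
theorem blockValue_left {n : FinCat} (x : X.obj n) :
    blockValue X Y ⟨⟨n, x⟩, fun _ => ⟨⟨1⟩, Y.one ⟨1⟩ rfl⟩⟩ ≍ Operad.Hom.app (bvInl X Y) x := by
  refine HEq.trans ?_ (heq_of_eq ((bvTensor X Y).mu_one (Operad.Hom.app (bvInl X Y) x)))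
  have hn : (⟨∑ _ : Fin n.len, 1⟩ : FinCat) = n := congrArg FinCat.mk (by simp)
  refine (bvTensor X Y).mu_congr hn rfl _ _ (FinCat.hom_heq hn rfl _ _ fun a b hab => ?_)
    _ _ _ _ _ _ (fun i i' _ => ?_) _ _ HEq.rfl
  · exact (sig_symm_fst_val (fun _ => rfl) a).trans hab
  · exact (heq_of_eq (Operad.Hom.map_one (bvInr X Y) ⟨1⟩ rfl)).trans
      ((bvTensor X Y).one_congr (fib_id n i') _ _)

variable (X Y) in
/-- The morphism to the tensor product with `[(x; y₁, …, yₙ)] ↦ μ^ν(y₁, …, yₙ, x)`. -/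
noncomputable def reflectToBv : reflect (Wreath (Groth X) (Groth Y)) ⟶ bvTensor X Y :=
  presentedLift _ (objValue X Y) fun n s t h => by
    cases h with
    | mu f ε z => exact blockValue_mu f
    | one U hU =>
      -- By connectedness (u; v) is the only chosen local terminal object, and its block composite
      -- is the unit.
      obtain rfl : (⟨⟨⟨1⟩, X.one ⟨1⟩ rfl⟩, fun _ => ⟨⟨1⟩, Y.one ⟨1⟩ rfl⟩⟩ :
          Wreath (Groth X) (Groth Y)) = U :=
        triv_unit.symm.trans ((triv_const _ U).trans hU)
      exact eq_of_heq ((cast_heq (congrArg (fun k => (bvTensor X Y).obj ⟨k⟩)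
        (card_of_triv hU)) _).trans ((blockValue_right _).trans (heq_of_eq
        (Operad.Hom.map_one (bvInr X Y) ⟨1⟩ rfl))))

variable (X Y) in
/-- The Boardman–Vogt tensor product is the reflection of the wreath product. -/
noncomputable def bvIsoReflect : bvTensor X Y ≅ reflect (Wreath (Groth X) (Groth Y)) where
  hom := bvToReflect X Y
  inv := reflectToBv X Y
  hom_inv_id := presented_hom_ext fun n e => by
    cases e with
    | inl x => exact eq_of_heq ((cast_heq _ _).trans (blockValue_left x))
    | inr y => exact eq_of_heq ((cast_heq (congrArg (fun k => (bvTensor X Y).obj ⟨k⟩)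
        (Fin.sum_univ_one fun _ => n.len)) _).trans (blockValue_right (X := X) y))
  inv_hom_id := presented_hom_ext fun n e => by
    obtain ⟨n⟩ := n
    obtain ⟨⟨T, ⟨⟩⟩, h⟩ := e
    dsimp only at h
    -- The generator now sits in its own arity, so the cast in `objValue` disappears and its value
    -- is literally a block composite.
    subst h
    exact (Operad.Hom.map_mu' (bvToReflect X Y) _ _ _ _ _).trans
      (blockMap_rightGen T.base.elt (fun i => card (T.elt i)) fun i => (T.elt i).elt)

end Generators

end WreathBV

theorem mainTheorem2 (X Y : Operad.{u} FinCat) :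
    ∃ e : bvTensor X Y ≅ reflect (Wreath (Groth X) (Groth Y)),
      (∀ (n : ℕ) (x : X.obj ⟨n⟩), Operad.Hom.app e.hom (Operad.Hom.app (bvInl X Y) x) =
        reflect.gen (O := Wreath (Groth X) (Groth Y))
          ⟨⟨⟨n⟩, x⟩, fun _ => ⟨⟨1⟩, Y.one ⟨1⟩ rfl⟩⟩ ⟨n⟩
          ((Finset.sum_const 1).trans (by simp [OperadicCategory.card]))) ∧
      (∀ (m : ℕ) (y : Y.obj ⟨m⟩), Operad.Hom.app e.hom (Operad.Hom.app (bvInr X Y) y) =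
        reflect.gen (O := Wreath (Groth X) (Groth Y))
          ⟨⟨⟨1⟩, X.one ⟨1⟩ rfl⟩, fun _ => ⟨⟨m⟩, y⟩⟩ ⟨m⟩ (Fin.sum_univ_one _)) ∧
      ∀ (n : ℕ) (x : X.obj ⟨n⟩) (k : Fin n → ℕ) (y : ∀ i, Y.obj ⟨k i⟩),
        Operad.Hom.app e.inv (reflect.gen (O := Wreath (Groth X) (Groth Y))
          ⟨⟨⟨n⟩, x⟩, fun i => ⟨⟨k i⟩, y i⟩⟩ ⟨∑ i, k i⟩ rfl) =
        (bvTensor X Y).mu (blockMap k) (fun i => ⟨k i⟩) (fib_blockMap k)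
          (fun i => Operad.Hom.app (bvInr X Y) (y i)) (Operad.Hom.app (bvInl X Y) x) :=
  -- Both morphisms are lifts from quotients and compute on generators; in the formula for the
  -- inverse the cast is along a reflexive equality.
  ⟨bvIsoReflect X Y, fun _ _ => rfl, fun _ _ => rfl, fun _ _ _ _ => rfl⟩
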